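/- **Conventions.** An $L_\infty$-algebra is a $\mathbb Z$-graded real vector space $V$ with multilinear graded antisymmetric brackets $\ell_k\colon V^{\otimes k}\to V$ ($k\ge 1$) of degree $2-k$ such that for all $n\ge 1$ and homogeneous $v_1,\dots,v_n$ $$\sum_{k=1}^n\ \sum_{\sigma\in \mathrm{Sh}(k,n-k)} (-1)^{n-k}\chi(\sigma)\,\ell_{n-k+1}\big(\ell_k(v_{\sigma(1)},\dots,v_{\sigma(k)}),v_{\sigma(k+1)},\dots,v_{\sigma(n)}\big)=0,$$ where $\chi(\sigma)$ is the sign of $\sigma$ times the Koszul sign. It is *cyclic* if it carries a nondegenerate graded symmetric bilinear pairing $\langle-,-\rangle$ with $\langle a,b\rangle=0$ unless $|a|+|b|=3$ (degree $-3$), such that all $\langle \ell_k(v_1,\dots,v_k),v_{k+1}\rangle$ are graded antisymmetric in the $k+1$ arguments. A *local* $L_\infty$-algebra on a smooth manifold $M$ (Hausdorff, $\sigma$-compact, without boundary) is an $L_\infty$-algebra $\mathcal M=\Gamma(M,E)$ with $E$ a graded vector bundle of finite rank, whose brackets are poly-differential operators. It is *cyclic* if there is a smooth, fibrewise nondegenerate,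 graded symmetric pairing $E\otimes E\to \mathrm{Dens}_M[-3]$ whose integral $\langle s,t\rangle=\int_M\langle s,t\rangle_E$ on the compactly supported sections $\mathcal M_c$ is invariant in the above sense. In the non-local case put $\mathcal M_c=\mathcal M$. An *action* of $\mathcal L$ on $\mathcal M$ is an $L_\infty$-structure $\ell^\ltimes$ on $\mathcal L\oplus\mathcal M$ (by poly-differential operators in the local case) for which $\mathcal M\to\mathcal L\oplus\mathcal M$ and $\mathcal L\oplus\mathcal M\to\mathcal L$ are strict maps of $L_\infty$-algebras. It is *compatible* with the pairing if $\langle \ell^\ltimes_{r+s}(X_1,\dots,X_r,m_1,\dots,m_s),m_{s+1}\rangle$ is graded antisymmetric in all arguments, for $s\ge1$, $X_i\in\mathcal L_c$, $m_j\in\mathcal M_c$. A *cochain* on $\mathcal L\oplus\mathcal M$ is a sequence $F=(F_n)_{n\ge1}$ of graded antisymmetric multilinear functionals on $\mathcal L_c\oplus\mathcal M_c$ (equivalently, graded symmetric functionals on the shift by $[1]$); it has degree $q$ if $F_n(v_1,\dots,v_n)=0$ unless $\sum_i(|v_i|-1)=-q$. In the local case each $F_n$ has to be the integral of a density given by a poly-differential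 operator. For a family of brackets $q$ let $$(d_qF)(v_1,\dots,v_n)=\sum_{k,\sigma}(-1)^{n-k}\chi(\sigma)F_{n-k+1}\big(q_k(v_{\sigma(1)},\dots,v_{\sigma(k)}),v_{\sigma(k+1)},\dots,v_{\sigma(n)}\big),$$ the sum being over all $(k,n-k)$-shuffles, $1\le k\le n$. If $S$ has degree $0$ and a Hamiltonian vector field $Y$, i.e. multilinear maps $Y_n$ with values in $\mathcal M_c$ and $S_{n+1}(p_1,\dots,p_n,m)=\langle Y_n(p_1,\dots,p_n),m\rangle$ for all $m\in\mathcal M_c$, put $\{S,F\}=d_YF$. The complex $\mathrm{Ham}(\mathcal L,\mathcal M)$ consists of the cochains, shifted by $[-1]$, which vanish when all arguments lie in $\mathcal M_c$; its differential is $d_{\mathcal L}+d_{\mathcal M}$ (taken for the direct sum of $\mathcal L$ and $\mathcal M$ without mixed brackets). A *Maurer–Cartan element* is an $S$ in it, of degree $0$ as a cochain, with a Hamiltonian vector field and $(d_{\mathcal L}+d_{\mathcal M})S+\tfrac12\{S,S\}=0$. It encodes the action $\ell^\ltimes$ if $S_{k+1}(p_1,\dots,p_k,m)=\langle \mathrm{pr}_{\mathcal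 M}\ell^\ltimes_k(p_1,\dots,p_k)-\ell_k(\mathrm{pr}_{\mathcal M}p_1,\dots,\mathrm{pr}_{\mathcal M}p_k),m\rangle$ for all $k$, all $p_i\in\mathcal L_c\oplus\mathcal M_c$ and all $m\in\mathcal M_c$. **Theorem 4.1.** Let $(\mathcal M,\{\ell_k\},\langle-,-\rangle)$ be a cyclic $L_\infty$-algebra, or a cyclic local $L_\infty$-algebra on a manifold $M$. For $p_i=(X_i,u_i)\in\mathcal M\oplus\mathcal M$ and $A\subsetneq\{1,\dots,k\}$ put $p_i^A=X_i$ if $i\in A$ and $p_i^A=u_i$ if $i\notin A$. Then the brackets $$\ell_k^\ltimes(p_1,\dots,p_k)=\Big(\ell_k(X_1,\dots,X_k),\ \sum_{A\subsetneq\{1,\dots,k\}}\ell_k(p_1^A,\dots,p_k^A)\Big)$$ are an action of $\mathcal M$ on itself, the infinity adjoint action (in the local case they are poly-differential operators, and they restrict to the compactly supported sections). Moreover: (a) The action is compatible with the pairing. (b) The action is Hamiltonian: there is a Maurer–Cartan element $S^{\mathcal L}$ of $\mathrm{Ham}(\mathcal M,\mathcal M)$ which encodes the action, and it can be chosen without terms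 that depend only on the acting copy of $\mathcal M$. (c) For this $S^{\mathcal L}$ the equivariant action is $S^{\mathrm{tot}}=S^{\mathcal L}+S^{\mathcal M}$, where $S^{\mathcal M}$ is given by $S^{\mathcal M}_{k+1}(m_1,\dots,m_{k+1})=\langle\ell_k(m_1,\dots,m_k),m_{k+1}\rangle$ on the second copy. $S^{\mathrm{tot}}$ is a cochain of degree $0$ (local in the local case), it satisfies the equivariant master equation $d_{\mathcal L}S^{\mathrm{tot}}+\tfrac12\{S^{\mathrm{tot}},S^{\mathrm{tot}}\}=0$, and it restricts to $S^{\mathcal M}$ when the background fields (the first copy) are set to zero. In particular, if only finitely many $\ell_k$ are nonzero and $S^{\mathrm{tot}}(X,\alpha)=\sum_n\frac1{n!}S^{\mathrm{tot}}_n((X,\alpha),\dots,(X,\alpha))$, then $S^{\mathrm{tot}}(0,\alpha)=\sum_{k\ge1}\frac1{(k+1)!}\langle\alpha,\ell_k(\alpha,\dots,\alpha)\rangle$, the classical action of $\mathcal M$, for all $\alpha\in\mathcal M_c$. -/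

import Mathlib

open Set Topology MeasureTheory Bundle
open scoped Manifold ContDiff Bundle

noncomputable section

/-! ## Graded signs -/

/-- The graded antisymmetric sign `χ(σ; d)` of a permutation `σ` acting on homogeneous elements of
degrees `d 0, …, d (n-1)`: the sign of `σ` times the Koszul sign, i.e. every inversion contributes
`-(-1)^{d d'}`. -/
def chiSign {n : ℕ} (d : Fin n → ℤ) (σ : Equiv.Perm (Fin n)) : ℤˣ :=
  ∏ a : Fin n, ∏ b ∈ Finset.univ.filter (fun b : Fin n => a < b ∧ σ b < σ a),
    -(d (σ a) * d (σ b)).negOnePow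

/-- A subset `S` of `{0, …, n-1}` is the same as a `(|S|, n-|S|)`-shuffle: list `S` increasingly, then
the complement of `S` increasingly.  `shuffleSign d S` is `(-1)^{n-|S|} χ(σ; d)` for that shuffle. -/
def shuffleSign {n : ℕ} (d : Fin n → ℤ) (S : Finset (Fin n)) : ℤˣ :=
  (-1) ^ (Sᶜ.card) * ∏ i ∈ S, ∏ j ∈ Sᶜ.filter (fun j => j < i), -(d i * d j).negOnePow

/-! ## `L∞`-algebras -/

section Algebra

/-- Families of multilinear maps `W^{⊗ k} → Z`, one for each arity `k`. -/
abbrev MultiFamily (W Z : Type*) [AddCommGroup W] [Module ℝ W] [AddCommGroup Z] [Module ℝ Z] :=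
  ∀ k : ℕ, MultilinearMap ℝ (fun _ : Fin k => W) Z

/-- Candidate brackets on `V`. -/
abbrev Brackets (V : Type*) [AddCommGroup V] [Module ℝ V] := MultiFamily V V

/-- Multilinear functionals of all arities on `W`.  By décalage the graded symmetric functionals on
`W[1]^{⊗ n}` are the graded antisymmetric functionals on `W^{⊗ n}`: a functional `F` of the latter
kind corresponds to `v ↦ (-1)^{∑ (n-i)(|v_i|-1)} F(v_1, …, v_n)`. Cochains are
written in the antisymmetric form. -/
abbrev Cochain (W : Type*) [AddCommGroup W] [Module ℝ W] := MultiFamily W ℝ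

variable {V W Z L M : Type*} [AddCommGroup V] [Module ℝ V] [AddCommGroup W] [Module ℝ W]
  [AddCommGroup Z] [Module ℝ Z] [AddCommGroup L] [Module ℝ L] [AddCommGroup M] [Module ℝ M]

/-- Graded antisymmetry of a multilinear map. -/
def GradedAntisymm (gr : ℤ → Submodule ℝ W) {k : ℕ}
    (f : MultilinearMap ℝ (fun _ : Fin k => W) Z) : Prop :=
  ∀ (d : Fin k → ℤ) (v : Fin k → W), (∀ i, v i ∈ gr (d i)) →
    ∀ σ : Equiv.Perm (Fin k), f (v ∘ σ) = chiSign d σ • f v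

/-- `∑_σ (-1)^{n-k} χ(σ; d) f_{n-k+1}(g_k(v_{σ(1)}, …, v_{σ(k)}), v_{σ(k+1)}, …, v_{σ(n)})`, the sum over
all `k` and all `(k, n-k)`-shuffles `σ`, for elements `v_i` of degree `d_i`. -/
def insertion (g : Brackets W) (f : MultiFamily W Z) {n : ℕ} (d : Fin n → ℤ) (v : Fin n → W) : Z :=
  ∑ S : Finset (Fin n), shuffleSign d S •
    f (Sᶜ.card + 1) (Fin.cons (g S.card (v ∘ S.orderEmbOfFin rfl)) (v ∘ Sᶜ.orderEmbOfFin rfl))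

/-- `L∞`-algebras (uncurved: the family of brackets starts in arity one), with
cohomological grading: `ℓ_k` has degree `2 - k`. -/
structure IsLInfinity (gr : ℤ → Submodule ℝ V) (br : Brackets V) : Prop where
  graded : DirectSum.IsInternal gr
  uncurved : br 0 = 0
  degree : ∀ (k : ℕ) (d : Fin k → ℤ) (v : Fin k → V), (∀ i, v i ∈ gr (d i)) →
    br k v ∈ gr (∑ i, d i + 2 - k)
  antisymm : ∀ k, GradedAntisymm gr (br k)
  jacobi : ∀ (n : ℕ) (d : Fin n → ℤ) (v : Fin n → V), (∀ i, v i ∈ gr (d i)) →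
    insertion br br d v = 0

/-- The functionals `(v_1, …, v_{n+1}) ↦ ⟨ℓ_n(v_1, …, v_n), v_{n+1}⟩`: the Taylor coefficients of the
classical action functional. -/
def classicalCochain (br : Brackets V) (B : V →ₗ[ℝ] V →ₗ[ℝ] ℝ) : Cochain V
  | 0 => 0
  | n + 1 => MultilinearMap.uncurryRight (M := fun _ : Fin (n + 1) => V) (B.compMultilinearMap (br n))

/-- Cyclic `L∞`-algebras with a pairing of degree `-3`. -/
structure IsCyclicLInfinity (gr : ℤ → Submodule ℝ V) (br : Brackets V)
    (B : V →ₗ[ℝ] V →ₗ[ℝ] ℝ) : Prop where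
  isLInfinity : IsLInfinity gr br
  symm : ∀ (d e : ℤ) (a b : V), a ∈ gr d → b ∈ gr e → B a b = (d * e).negOnePow • B b a
  degree : ∀ (d e : ℤ) (a b : V), a ∈ gr d → b ∈ gr e → d + e ≠ 3 → B a b = 0
  nondegenerate : ∀ a : V, (∀ b, B a b = 0) → a = 0
  invariant : ∀ n, GradedAntisymm gr (classicalCochain br B n)

/-- The classical action `S(α) = ∑_{k ≥ 1} 1/(k+1)! ⟨α, ℓ_k(α, …, α)⟩` (used when only finitely many
brackets are nonzero). -/
def classicalAction (br : Brackets V) (B : V →ₗ[ℝ] V →ₗ[ℝ] ℝ) (α : V) : ℝ :=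
  ∑ᶠ k : ℕ, if 1 ≤ k then ((Nat.factorial (k + 1) : ℝ))⁻¹ * B α (br k (fun _ => α)) else 0

/-- The function `w ↦ ∑ₙ 1/n! F_n(w, …, w)` with Taylor coefficients `F_n`. -/
def Cochain.eval (F : Cochain W) (w : W) : ℝ :=
  ∑ᶠ n : ℕ, ((Nat.factorial n : ℝ))⁻¹ * F n (fun _ => w)

/-! ## Actions -/

/-- The grading of `L ⊕ M`. -/
def sumGr (grL : ℤ → Submodule ℝ L) (grM : ℤ → Submodule ℝ M) : ℤ → Submodule ℝ (L × M) :=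
  fun d => (grL d).prod (grM d)

/-- The brackets of the direct sum (without mixed terms) of `L` and `M`. -/
def sumBr (brL : Brackets L) (brM : Brackets M) : Brackets (L × M) := fun k =>
  ((brL k).compLinearMap (fun _ => LinearMap.fst ℝ L M)).prod
    ((brM k).compLinearMap (fun _ => LinearMap.snd ℝ L M))

/-- `br` is an action of `L` on `M`: an `L∞`-structure on `L ⊕ M` such that the inclusion
`M → L ⊕ M` and the projection `L ⊕ M → L` (which form a short exact sequence of graded vector
spaces) are strict maps of `L∞`-algebras. -/
structure IsAction (grL : ℤ → Submodule ℝ L) (brL : Brackets L) (grM : ℤ → Submodule ℝ M)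
    (brM : Brackets M) (br : Brackets (L × M)) : Prop where
  isLInfinity : IsLInfinity (sumGr grL grM) br
  incl : ∀ (k : ℕ) (m : Fin k → M), br k (fun i => (0, m i)) = (0, brM k m)
  proj : ∀ (k : ℕ) (p : Fin k → L × M), (br k p).1 = brL k (fun i => (p i).1)

/-- Compatibility of an action with the pairing on `M`: `⟨ℓ_k(p_1, …, p_k), p_{k+1}⟩` is graded
antisymmetric in all arguments, elements of `L` or of `M`, whenever it is defined (that is, under
all permutations of the arguments which put an element of `M` in the last place). -/
def IsCompatible (grL : ℤ → Submodule ℝ L) (grM : ℤ → Submodule ℝ M)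
    (br : Brackets (L × M)) (B : M →ₗ[ℝ] M →ₗ[ℝ] ℝ) : Prop :=
  ∀ (k : ℕ) (d : Fin (k + 1) → ℤ) (p : Fin (k + 1) → L × M) (σ : Equiv.Perm (Fin (k + 1))),
    (∀ i, p i ∈ sumGr grL grM (d i)) →
    (p (Fin.last k)).1 = 0 → (p (σ (Fin.last k))).1 = 0 →
    B (br k (fun i => p (σ i.castSucc))).2 (p (σ (Fin.last k))).2 =
      chiSign d σ • B (br k (fun i => p i.castSucc)).2 (p (Fin.last k)).2

/-! ## Cochains, the Hamiltonian action complex, Maurer-Cartan elements -/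

/-- `F` is a reduced cochain of degree `q`: no constant term, graded antisymmetric, and
of degree `q` as a functional on `W[1]`. -/
structure IsRedCochain (gr : ℤ → Submodule ℝ W) (q : ℤ) (F : Cochain W) : Prop where
  reduced : F 0 = 0
  antisymm : ∀ n, GradedAntisymm gr (F n)
  degree : ∀ (n : ℕ) (d : Fin n → ℤ) (v : Fin n → W), (∀ i, v i ∈ gr (d i)) →
    ∑ i, (d i - 1) ≠ -q → F n v = 0

/-- `F` is an element of degree `q` of the Hamiltonian action complex, the kernel of the restriction
`C_red(L ⊕ M)[-1] → C_red(M)[-1]`. -/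
structure IsHam (grL : ℤ → Submodule ℝ L) (grM : ℤ → Submodule ℝ M) (q : ℤ)
    (F : Cochain (L × M)) : Prop where
  isRedCochain : IsRedCochain (sumGr grL grM) (q - 1) F
  restrict : ∀ (n : ℕ) (m : Fin n → M), F n (fun i => (0, m i)) = 0

/-- `Y` is the Hamiltonian vector field, along `M` and with coefficients depending on `L ⊕ M`, of
the functional `G` (of degree `0` as a functional on `L[1] ⊕ M[1]`):
`G(p_1, …, p_n, m) = ⟨Y(p_1, …, p_n), m⟩`. -/
def IsHamiltonianVF (B : M →ₗ[ℝ] M →ₗ[ℝ] ℝ) (G : Cochain (L × M)) (Y : MultiFamily (L × M) M) :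
    Prop :=
  ∀ (n : ℕ) (p : Fin n → L × M) (m : M),
    G (n + 1) (Fin.snoc (α := fun _ => L × M) p (0, m)) = B (Y n p) m

/-- The derivative of `F` along a vector field `Y` in the direction of `M`.  If `Y` is the
Hamiltonian vector field of `G`, this is the Poisson bracket `{G, F}`
induced by the pairing on `M`. -/
def alongM (Y : MultiFamily (L × M) M) (F : Cochain (L × M)) {n : ℕ}
    (d : Fin n → ℤ) (p : Fin n → L × M) : ℝ :=
  insertion (fun k => (LinearMap.inr ℝ L M).compMultilinearMap (Y k)) F d p

/-- The Maurer-Cartan equation `D S + ½ {S, S} = 0`, where `D` is the Chevalley-Eilenberg differential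
of the brackets `q` on `L ⊕ M` and `{-, -}` is the Poisson bracket induced by the pairing on `M`.  Part
of the claim is that `S` has a Hamiltonian vector field `Y`; it is unique when the pairing is
nondegenerate. -/
def IsMaurerCartan (gr : ℤ → Submodule ℝ (L × M)) (q : Brackets (L × M))
    (B : M →ₗ[ℝ] M →ₗ[ℝ] ℝ) (S : Cochain (L × M)) : Prop :=
  ∃ Y : MultiFamily (L × M) M, IsHamiltonianVF B S Y ∧
    ∀ (n : ℕ) (d : Fin n → ℤ) (p : Fin n → L × M), (∀ i, p i ∈ gr (d i)) →
      insertion q S d p + (1 / 2 : ℝ) * alongM Y S d p = 0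

/-- The vector field along `M` of an action: the `M`-component of the brackets on `L ⊕ M`, minus the
brackets of `M` itself. -/
def actionVF (brM : Brackets M) (br : Brackets (L × M)) : MultiFamily (L × M) M := fun k =>
  (LinearMap.snd ℝ L M).compMultilinearMap (br k) -
    (brM k).compLinearMap (fun _ => LinearMap.snd ℝ L M)

/-- `S` exhibits the action `br` of `L` on `M` as Hamiltonian: it is a Maurer-Cartan element of the
Hamiltonian action complex which encodes the brackets of the action. The differential is
that of the direct sum of `L` and `M`.  Last, `S` is the naive lift of the action: it has no terms
depending on `L` alone. -/
structure IsHamiltonianBy (grL : ℤ → Submodule ℝ L) (brL : Brackets L) (grM : ℤ → Submodule ℝ M)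
    (brM : Brackets M) (B : M →ₗ[ℝ] M →ₗ[ℝ] ℝ) (br : Brackets (L × M)) (S : Cochain (L × M)) :
    Prop where
  isHam : IsHam grL grM 1 S
  maurerCartan : IsMaurerCartan (sumGr grL grM) (sumBr brL brM) B S
  encodes : IsHamiltonianVF B S (actionVF brM br)
  naive : ∀ (n : ℕ) (X : Fin n → L), S n (fun i => (X i, 0)) = 0

/-- The total (equivariant) action `S^tot = S^L + S^M`, where `S^M` is the classical action of `M`,
regarded as a functional on `L ⊕ M`. -/
def totalCochain (brM : Brackets M) (B : M →ₗ[ℝ] M →ₗ[ℝ] ℝ) (SL : Cochain (L × M)) :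
    Cochain (L × M) := fun n =>
  SL n + (classicalCochain brM B n).compLinearMap (fun _ => LinearMap.snd ℝ L M)

/-- The properties of the equivariant action: it is a functional of degree `0` on `L[1] ⊕ M[1]`, it
satisfies the equivariant classical master equation `d_L S + ½ {S, S} = 0`, and
for zero background fields it is the classical action of `M` (as a formal functional and, when there
are only finitely many brackets, as a function on fields). -/
structure IsEquivariantAction (grL : ℤ → Submodule ℝ L) (brL : Brackets L)
    (grM : ℤ → Submodule ℝ M) (brM : Brackets M) (B : M →ₗ[ℝ] M →ₗ[ℝ] ℝ)
    (S : Cochain (L × M)) : Prop where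
  isRedCochain : IsRedCochain (sumGr grL grM) 0 S
  master : IsMaurerCartan (sumGr grL grM) (sumBr brL 0) B S
  restrict : ∀ (n : ℕ) (m : Fin n → M), S n (fun i => (0, m i)) = classicalCochain brM B n m
  restrict_eval : (∃ N, ∀ k, N < k → brM k = 0) →
    ∀ α : M, S.eval (0, α) = classicalAction brM B α

/-! ## The infinity adjoint action -/

/-- The brackets of the infinity adjoint action: for `p_i = (X_i, u_i)`,
`ℓ_k(p_1, …, p_k) = (ℓ_k(X_1, …, X_k), ∑_{A ⊊ {1, …, k}} ℓ_k(p_1^A, …, p_k^A))` with `p_i^A = X_i` for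
`i ∈ A` and `p_i^A = u_i` for `i ∉ A`. -/
def infAdjoint (br : Brackets V) : Brackets (V × V) := fun k =>
  ((br k).compLinearMap (fun _ => LinearMap.fst ℝ V V)).prod
    (∑ A ∈ (Finset.univ : Finset (Fin k)).ssubsets,
      (br k).compLinearMap
        (fun i => if i ∈ A then LinearMap.fst ℝ V V else LinearMap.snd ℝ V V))

/-- Restriction of brackets to a subspace that is closed under them. -/
def restrictBr (br : Brackets V) (U : Submodule ℝ V)
    (h : ∀ (k : ℕ) (v : Fin k → V), (∀ i, v i ∈ U) → br k v ∈ U) : Brackets U := fun k =>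
  ((br k).compLinearMap (fun _ => U.subtype)).codRestrict U (fun v => h k _ (fun i => (v i).2))

end Algebra

/-! ## Densities on a manifold -/

section Densities

variable (n : ℕ) {M : Type*} [TopologicalSpace M] [ChartedSpace (EuclideanSpace ℝ (Fin n)) M]

/-- Densities at the point `x`: functions of `n` tangent vectors which are multiplied by `|det A|`
when an endomorphism `A` is applied to the vectors. -/
def DensityAt (x : M) : Submodule ℝ ((Fin n → TangentSpace (𝓡 n) x) → ℝ) where
  carrier := {μ | ∀ (A : TangentSpace (𝓡 n) x →ₗ[ℝ] TangentSpace (𝓡 n) x)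
    (v : Fin n → TangentSpace (𝓡 n) x), μ (fun i => A (v i)) = |LinearMap.det A| * μ v}
  add_mem' := by
    intro a b ha hb A v
    simp only [Pi.add_apply, ha A v, hb A v, mul_add]
  zero_mem' := by
    intro A v
    simp
  smul_mem' := by
    intro c a ha A v
    simp only [Pi.smul_apply, smul_eq_mul, ha A v]
    ring

/-- The coordinate expression of a density in the chart around `c`: its value on the coordinate
frame. -/
def densCoord (μ : ∀ x : M, DensityAt n x) (c : M) (y : EuclideanSpace ℝ (Fin n)) : ℝ :=
  (μ ((chartAt (EuclideanSpace ℝ (Fin n)) c).symm y)).1 (fun i =>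
    mfderiv (𝓡 n) (𝓡 n) (chartAt (EuclideanSpace ℝ (Fin n)) c).symm y
      (EuclideanSpace.single i (1 : ℝ)))

variable (M) in
/-- Smooth densities, the sections of `Dens_M`. -/
def SmoothDensity : Submodule ℝ (∀ x : M, DensityAt n x) where
  carrier := {μ | ∀ c : M, ContDiffOn ℝ ∞ (densCoord n μ c)
    (chartAt (EuclideanSpace ℝ (Fin n)) c).target}
  add_mem' := fun ha hb c => (ha c).add (hb c)
  zero_mem' := fun _ => contDiffOn_const (c := (0 : ℝ))
  smul_mem' := fun _ _ ha c => contDiffOn_const.smul (ha c)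

variable (M) in
/-- A smooth partition of unity subordinate to the coordinate charts. -/
def chartPartition [IsManifold (𝓡 n) ∞ M] [T2Space M] [SigmaCompactSpace M] :
    SmoothPartitionOfUnity M (𝓡 n) M univ :=
  (SmoothPartitionOfUnity.exists_isSubordinate_chartAt_source (𝓡 n) M).choose

/-- The integral of a compactly supported density, computed in charts with a partition of
unity. -/
def densInt [IsManifold (𝓡 n) ∞ M] [T2Space M] [SigmaCompactSpace M]
    (μ : ∀ x : M, DensityAt n x) : ℝ :=
  ∑ᶠ c : M, ∫ y in (chartAt (EuclideanSpace ℝ (Fin n)) c).target,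
    chartPartition n M c ((chartAt (EuclideanSpace ℝ (Fin n)) c).symm y) * densCoord n μ c y

/-- Compactly supported densities. -/
def DensCompact (μ : ∀ x : M, DensityAt n x) : Prop := ∃ K : Set M, IsCompact K ∧ ∀ x ∉ K, μ x = 0

section IntegralLemmas

variable [IsManifold (𝓡 n) ∞ M] [T2Space M] [SigmaCompactSpace M]

lemma chartPartition_subordinate :
    (chartPartition n M).IsSubordinate
      (fun x => (chartAt (EuclideanSpace ℝ (Fin n)) x).source) :=
  (SmoothPartitionOfUnity.exists_isSubordinate_chartAt_source (𝓡 n) M).choose_spec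

lemma densInt_finite {μ : ∀ x : M, DensityAt n x} (hc : DensCompact n μ) :
    (Function.support (fun c : M => ∫ y in (chartAt (EuclideanSpace ℝ (Fin n)) c).target,
      chartPartition n M c ((chartAt (EuclideanSpace ℝ (Fin n)) c).symm y) *
        densCoord n μ c y)).Finite := by
  obtain ⟨K, hK, h0⟩ := hc
  refine ((chartPartition n M).locallyFinite.finite_nonempty_inter_compact hK).subset ?_
  intro c hcs
  by_contra hne
  apply hcs
  have : ∀ y, chartPartition n M c ((chartAt (EuclideanSpace ℝ (Fin n)) c).symm y) *
      densCoord n μ c y = 0 := by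
    intro y
    by_cases hy : (chartAt (EuclideanSpace ℝ (Fin n)) c).symm y ∈ K
    · have : chartPartition n M c ((chartAt (EuclideanSpace ℝ (Fin n)) c).symm y) = 0 := by
        by_contra h
        exact hne ⟨_, h, hy⟩
      rw [this, zero_mul]
    · unfold densCoord
      rw [h0 _ hy]
      simp
  simp [this]

lemma densInt_integrable {μ : ∀ x : M, DensityAt n x} (hs : μ ∈ SmoothDensity n M)
    (hc : DensCompact n μ) (c : M) :
    IntegrableOn (fun y => chartPartition n M c
      ((chartAt (EuclideanSpace ℝ (Fin n)) c).symm y) * densCoord n μ c y)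
      (chartAt (EuclideanSpace ℝ (Fin n)) c).target := by
  obtain ⟨K, hK, h0⟩ := hc
  set e := chartAt (EuclideanSpace ℝ (Fin n)) c with he
  set C : Set (EuclideanSpace ℝ (Fin n)) := e '' (tsupport (chartPartition n M c) ∩ K) with hC
  have hsub : tsupport (chartPartition n M c) ∩ K ⊆ e.source :=
    fun x hx => chartPartition_subordinate n c hx.1
  have hCc : IsCompact C :=
    (hK.inter_left (isClosed_tsupport _)).image_of_continuousOn (e.continuousOn.mono hsub)
  have hCt : C ⊆ e.target := by
    rintro _ ⟨x, hx, rfl⟩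
    exact e.map_source (hsub hx)
  have hcont : ContinuousOn (fun y => chartPartition n M c (e.symm y) * densCoord n μ c y)
      e.target :=
    (((chartPartition n M c).2.continuous).comp_continuousOn e.continuousOn_symm).mul
      (hs c).continuousOn
  have h1 : IntegrableOn (fun y => chartPartition n M c (e.symm y) * densCoord n μ c y) C :=
    (hcont.mono hCt).integrableOn_compact hCc
  refine h1.of_forall_sdiff_eq_zero e.open_target.measurableSet ?_
  rintro y ⟨hy, hyC⟩
  by_cases hK' : e.symm y ∈ K
  · have : e.symm y ∉ tsupport (chartPartition n M c) := by
      intro h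
      exact hyC ⟨e.symm y, ⟨h, hK'⟩, e.right_inv hy⟩
    rw [image_eq_zero_of_notMem_tsupport this, zero_mul]
  · unfold densCoord
    rw [h0 _ hK']
    simp

lemma densInt_add {μ ν : ∀ x : M, DensityAt n x} (hμ : μ ∈ SmoothDensity n M)
    (hν : ν ∈ SmoothDensity n M) (hμc : DensCompact n μ) (hνc : DensCompact n ν) :
    densInt n (μ + ν) = densInt n μ + densInt n ν := by
  unfold densInt
  rw [← finsum_add_distrib (densInt_finite n hμc) (densInt_finite n hνc)]
  refine finsum_congr fun c => ?_
  rw [← integral_add (densInt_integrable n hμ hμc c) (densInt_integrable n hν hνc c)]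
  refine integral_congr_ae (Filter.Eventually.of_forall fun y => ?_)
  simp [densCoord, mul_add]

lemma densInt_smul (r : ℝ) (μ : ∀ x : M, DensityAt n x) :
    densInt n (r • μ) = r * densInt n μ := by
  unfold densInt
  rw [← smul_eq_mul, smul_finsum]
  refine finsum_congr fun c => ?_
  rw [smul_eq_mul, ← integral_const_mul]
  refine integral_congr_ae (Filter.Eventually.of_forall fun y => ?_)
  simp only [densCoord, Pi.smul_apply, Submodule.coe_smul, smul_eq_mul]
  ring

end IntegralLemmas

end Densities

/-! ## Local `L∞`-algebras -/

section Local

variable (n : ℕ) {M : Type*} [TopologicalSpace M] [ChartedSpace (EuclideanSpace ℝ (Fin n)) M]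
  (F : Type*) [NormedAddCommGroup F] [NormedSpace ℝ F]
  (E : M → Type*) [TopologicalSpace (TotalSpace F E)] [∀ x, TopologicalSpace (E x)]
  [FiberBundle F E] [∀ x, AddCommGroup (E x)] [∀ x, Module ℝ (E x)] [VectorBundle ℝ F E]

/-- Smooth sections of the vector bundle `E`. -/
abbrev Sec := ContMDiffSection (𝓡 n) F ∞ E

/-- A grading of the vector bundle `E`, i.e. a decomposition of `E` into the direct sum of
subbundles `E^d`, `d ∈ ℤ`, given by the smooth projections to the summands. -/
structure BundleGrading where
  proj : ℤ → ∀ x : M, E x →ₗ[ℝ] E x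
  degrees : Finset ℤ
  proj_proj : ∀ (d e : ℤ) (x : M) (a : E x),
    proj d x (proj e x a) = if d = e then proj d x a else 0
  sum_proj : ∀ (x : M) (a : E x), ∑ d ∈ degrees, proj d x a = a
  smooth : ∀ (d : ℤ) (s : Sec n F E),
    ContMDiff (𝓡 n) ((𝓡 n).prod 𝓘(ℝ, F)) ∞ (fun x => TotalSpace.mk' F x (proj d x (s x)))

variable {n F E}

/-- The induced grading on the space of sections. -/
def BundleGrading.gr (G : BundleGrading n F E) (d : ℤ) : Submodule ℝ (Sec n F E) where
  carrier := {s | ∀ x, G.proj d x (s x) = s x}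
  add_mem' := by
    intro s t hs ht x
    simp only [ContMDiffSection.coe_add, Pi.add_apply, map_add, hs x, ht x]
  zero_mem' := by
    intro x
    simp
  smul_mem' := by
    intro c s hs x
    simp only [ContMDiffSection.coe_smul, Pi.smul_apply, map_smul, hs x]

variable (n F E) in
/-- Compactly supported sections. -/
def CSec : Submodule ℝ (Sec n F E) where
  carrier := {s | ∃ K : Set M, IsCompact K ∧ ∀ x ∉ K, s x = 0}
  add_mem' := by
    rintro s t ⟨K, hK, hs⟩ ⟨K', hK', ht⟩
    refine ⟨K ∪ K', hK.union hK', fun x hx => ?_⟩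
    rw [mem_union, not_or] at hx
    simp [hs x hx.1, ht x hx.2]
  zero_mem' := ⟨∅, isCompact_empty, fun x _ => by simp⟩
  smul_mem' := by
    rintro c s ⟨K, hK, hs⟩
    exact ⟨K, hK, fun x hx => by simp [hs x hx]⟩

/-- The grading on compactly supported sections. -/
def BundleGrading.grc (G : BundleGrading n F E) (d : ℤ) : Submodule ℝ (CSec n F E) :=
  (G.gr d).comap (CSec n F E).subtype

/-- `s` is a product of `r + 1` smooth functions vanishing at `x` and a section. (Finite sums of such
sections are the sections whose `r`-jet at `x` vanishes.) -/
def VanishesToOrder (r : ℕ) (x : M) (s : Sec n F E) : Prop :=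
  ∃ (f : Fin (r + 1) → ContMDiffMap (𝓡 n) 𝓘(ℝ, ℝ) M ℝ ∞) (t : Sec n F E),
    (∀ j, f j x = 0) ∧ ∀ y, s y = (∏ j, f j y) • t y

/-- The same for sections of the Whitney sum `E ⊕ E`. -/
def VanishesToOrderSum (r : ℕ) (x : M) (p : Sec n F E × Sec n F E) : Prop :=
  VanishesToOrder r x p.1 ∧ VanishesToOrder r x p.2

/-- A multilinear map from sections to sections is a poly-differential operator of finite order if,
for some `r` and in each argument, its value at a point `x` depends only on
the `r`-jet of that argument at `x`, i.e. it vanishes at `x` if the `r`-jet of an argument does.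
Since smooth sections go to smooth sections, the coefficients are smooth. Here
`van r x` says that an argument vanishes at `x` to order `r`, and `zero x` that the value vanishes at
`x`. -/
def IsPolyDiff {V Z : Type*} [AddCommGroup V] [Module ℝ V] [AddCommGroup Z] [Module ℝ Z] {k : ℕ}
    (van : ℕ → M → V → Prop) (zero : M → Z → Prop)
    (P : MultilinearMap ℝ (fun _ : Fin k => V) Z) : Prop :=
  ∃ r : ℕ, ∀ (v : Fin k → V) (i : Fin k) (x : M), van r x (v i) → zero x (P v)

/-- Local `L∞`-algebras: the brackets on sections are poly-differential operators. -/
structure IsLocalLInfinity (G : BundleGrading n F E) (br : Brackets (Sec n F E)) : Prop where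
  isLInfinity : IsLInfinity G.gr br
  isPolyDiff : ∀ k, IsPolyDiff VanishesToOrder (fun x s => s x = 0) (br k)

lemma IsLocalLInfinity.cSec [FiniteDimensional ℝ F] [IsManifold (𝓡 n) ∞ M] [T2Space M]
    [SigmaCompactSpace M] {G : BundleGrading n F E} {br : Brackets (Sec n F E)}
    (h : IsLocalLInfinity G br) (k : ℕ) (v : Fin k → Sec n F E) (hv : ∀ i, v i ∈ CSec n F E) :
    br k v ∈ CSec n F E := by
  rcases k with _ | k
  · rw [h.isLInfinity.uncurved]
    exact Submodule.zero_mem _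
  obtain ⟨K, hK, h0⟩ := hv 0
  obtain ⟨r, hr⟩ := h.isPolyDiff (k + 1)
  refine ⟨K, hK, fun x hx => hr v 0 x ?_⟩
  obtain ⟨f, hf0, hf1, -⟩ := exists_contMDiffMap_zero_one_of_isClosed (𝓡 n) (n := (⊤ : ℕ∞))
    (isClosed_singleton (x := x)) hK.isClosed (by simpa using hx)
  refine ⟨fun _ => f, v 0, fun _ => hf0 rfl, fun y => ?_⟩
  by_cases hy : y ∈ K
  · have : f y = 1 := hf1 hy
    simp [this]
  · simp [h0 y hy]

/-- The brackets on compactly supported sections. -/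
def IsLocalLInfinity.cBr [FiniteDimensional ℝ F] [IsManifold (𝓡 n) ∞ M] [T2Space M]
    [SigmaCompactSpace M] {G : BundleGrading n F E} {br : Brackets (Sec n F E)}
    (h : IsLocalLInfinity G br) : Brackets (CSec n F E) :=
  restrictBr br (CSec n F E) h.cSec

variable (n F E) in
/-- Smooth bilinear maps of vector bundles `E ⊗ E → Dens_M`. -/
structure BundlePairing where
  pair : ∀ x : M, E x →ₗ[ℝ] E x →ₗ[ℝ] DensityAt n x
  smooth : ∀ s t : Sec n F E, (fun x => pair x (s x) (t x)) ∈ SmoothDensity n M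

lemma BundlePairing.compact (P : BundlePairing n F E) (s t : CSec n F E) :
    DensCompact n (fun x => P.pair x (s.1 x) (t.1 x)) := by
  obtain ⟨K, hK, h0⟩ := s.2
  exact ⟨K, hK, fun x hx => by simp [h0 x hx]⟩

/-- The induced pairing `∫_M ⟨s, t⟩` on compactly supported sections. -/
def BundlePairing.int [IsManifold (𝓡 n) ∞ M] [T2Space M] [SigmaCompactSpace M]
    (P : BundlePairing n F E) : CSec n F E →ₗ[ℝ] CSec n F E →ₗ[ℝ] ℝ :=
  LinearMap.mk₂ ℝ (fun s t => densInt n (fun x => P.pair x (s.1 x) (t.1 x)))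
    (fun s s' t => by
      rw [← densInt_add n (P.smooth s.1 t.1) (P.smooth s'.1 t.1) (P.compact s t) (P.compact s' t)]
      congr 1
      funext x
      simp)
    (fun c s t => by
      rw [smul_eq_mul, ← densInt_smul]
      congr 1
      funext x
      simp)
    (fun s t t' => by
      rw [← densInt_add n (P.smooth s.1 t.1) (P.smooth s.1 t'.1) (P.compact s t) (P.compact s t')]
      congr 1
      funext x
      simp)
    (fun c s t => by
      rw [smul_eq_mul, ← densInt_smul]
      congr 1
      funext x
      simp)

/-- Cyclic local `L∞`-algebras, with a pairing `E ⊗ E → Dens_M[-3]`. -/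
structure IsLocalCyclicLInfinity [FiniteDimensional ℝ F] [IsManifold (𝓡 n) ∞ M] [T2Space M]
    [SigmaCompactSpace M] (G : BundleGrading n F E) (br : Brackets (Sec n F E))
    (P : BundlePairing n F E) : Prop where
  isLocal : IsLocalLInfinity G br
  symm : ∀ (d e : ℤ) (x : M) (a b : E x), G.proj d x a = a → G.proj e x b = b →
    P.pair x a b = (d * e).negOnePow • P.pair x b a
  degree : ∀ (d e : ℤ) (x : M) (a b : E x), G.proj d x a = a → G.proj e x b = b → d + e ≠ 3 →
    P.pair x a b = 0
  nondegenerate : ∀ (x : M) (a : E x), (∀ b, P.pair x a b = 0) → a = 0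
  invariant : ∀ k, GradedAntisymm G.grc
    (classicalCochain isLocal.cBr P.int k)

/-- Local functionals of compactly supported fields in `E ⊕ E`: integrals of
densities which are given by poly-differential operators. -/
def IsLocalFunctional [IsManifold (𝓡 n) ∞ M] [T2Space M] [SigmaCompactSpace M] {k : ℕ}
    (S : MultilinearMap ℝ (fun _ : Fin k => CSec n F E × CSec n F E) ℝ) : Prop :=
  ∃ P : MultilinearMap ℝ (fun _ : Fin k => Sec n F E × Sec n F E) (SmoothDensity n M),
    IsPolyDiff VanishesToOrderSum (fun x (μ : SmoothDensity n M) => μ.1 x = 0) P ∧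
    ∀ p : Fin k → CSec n F E × CSec n F E,
      S p = densInt n (P (fun i => ((p i).1.1, (p i).2.1))).1

end Local

end

/-! ## Signs of shuffles -/

section Signs

/-! Everything rests on the substitution w = X + u. In the coordinates (X, w) the infinity adjoint
brackets are the direct sum of two copies of the given algebra, because their second component is
ℓ(X + u) - ℓ(X) (`infAdjoint_snd`). Degree, antisymmetry and the Jacobi identity are therefore
inherited from ℓ, and compatibility with the pairing comes from cyclic invariance.

Let S be the classical functional, so that S'(v) = ⟨ℓ(v), -⟩. The total action is S(X + u) - S(X) -
S'(X)u (`equivariantLift`), and the Maurer-Cartan element is obtained from it by subtracting S(u)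
(`actionLift`). The linear term is removed so that the Hamiltonian vector field of the total action
is exactly ℓ(X + u) - ℓ(X).

Both master equations reduce to one expression (v, w), the derivative of S at w along ℓ(v), which is
⟨ℓ(w), ℓ(v)⟩ up to signs. It is symmetric (`insertValues_comm`, from the sign identity `term_compl`)
and vanishes on the diagonal (`insertValues_self`), where it is twice a Jacobi identity paired with
one argument, up to sign. Polarizing the diagonal identity also kills S''(X)(ℓ(X), u)
(`sum_update_eq_zero`). For the total action, the differential of the acting copy then gives (X, w)
and half the Poisson bracket gives -(X, w).

In the local case the compactly supported sections with the integrated pairing form a cyclic algebra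
(`IsLocalCyclicLInfinity.isCyclicLInfinity_cBr`), to which the same argument applies; nondegeneracy
needs bump functions and positivity of the integral (`densInt_pos`). The lifts are algebraic
formulas that commute with linear maps, so they can be formed for density-valued functionals before
integration, which gives locality. -/

lemma neg_one_pow_eq_negOnePow (m : ℕ) : ((-1) ^ m : ℤˣ) = (m : ℤ).negOnePow := by
  simp [Int.negOnePow]

lemma neg_negOnePow (m : ℤ) : -m.negOnePow = (m + 1).negOnePow := by
  rw [Int.negOnePow_succ]

lemma negOnePow_sum {ι : Type*} (s : Finset ι) (f : ι → ℤ) :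
    ∏ i ∈ s, (f i).negOnePow = (∑ i ∈ s, f i).negOnePow := by
  classical
  induction s using Finset.induction_on with
  | empty => simp
  | insert a s ha ih => rw [Finset.prod_insert ha, Finset.sum_insert ha, ih, Int.negOnePow_add]

variable {n : ℕ}

/-- The exponent of the sign contributed by the inversions of the shuffle given by `S`. -/
def inversionExponent (d : Fin n → ℤ) (S : Finset (Fin n)) : ℤ :=
  ∑ i ∈ S, ∑ j ∈ Sᶜ.filter (fun j => j < i), (d i * d j + 1)

lemma shuffleSign_eq_negOnePow (d : Fin n → ℤ) (S : Finset (Fin n)) :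
    shuffleSign d S = ((Sᶜ.card : ℤ) + inversionExponent d S).negOnePow := by
  rw [Int.negOnePow_add, inversionExponent, ← negOnePow_sum]
  simp only [shuffleSign, neg_one_pow_eq_negOnePow, neg_negOnePow, negOnePow_sum]

/-- A pair with one index in S and the other outside is an inversion for exactly one of the two
shuffles, so together they count each such pair once. -/
lemma inversionExponent_add_compl (d : Fin n → ℤ) (S : Finset (Fin n)) :
    inversionExponent d S + inversionExponent d Sᶜ =
      (∑ i ∈ S, d i) * (∑ j ∈ Sᶜ, d j) + (S.card : ℤ) * Sᶜ.card := by
  have h2 : inversionExponent d Sᶜ =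
      ∑ i ∈ S, ∑ j ∈ Sᶜ.filter (fun j => ¬ j < i), (d i * d j + 1) := by
    unfold inversionExponent
    rw [compl_compl]
    simp only [Finset.sum_filter]
    rw [Finset.sum_comm]
    refine Finset.sum_congr rfl fun i hi => Finset.sum_congr rfl fun j hj => ?_
    have hne : i ≠ j := by
      rintro rfl
      exact Finset.mem_compl.1 hj hi
    have : (i < j) ↔ ¬ j < i := by
      rw [not_lt]
      exact ⟨le_of_lt, fun h => lt_of_le_of_ne h hne⟩
    simp only [this, mul_comm (d j)]
  rw [h2, inversionExponent, ← Finset.sum_add_distrib]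
  have h3 : ∀ i, ∑ j ∈ Sᶜ.filter (fun j => j < i), (d i * d j + 1) +
      ∑ j ∈ Sᶜ.filter (fun j => ¬ j < i), (d i * d j + 1) = d i * ∑ j ∈ Sᶜ, d j + Sᶜ.card :=
    fun i => by
      rw [Finset.sum_filter_add_sum_filter_not, Finset.sum_add_distrib, Finset.mul_sum,
        Finset.sum_const, nsmul_one]
  rw [Finset.sum_congr rfl fun i _ => h3 i, Finset.sum_add_distrib, ← Finset.sum_mul,
    Finset.sum_const, nsmul_eq_mul]

/-- The only inversions pair the last position, which receives the argument with index 0, with each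
of the n earlier positions. -/
lemma chiSign_finRotate (d : Fin (n + 1) → ℤ) :
    chiSign d (finRotate (n + 1)) = (n + d 0 * ∑ i : Fin n, d i.succ).negOnePow := by
  have hlast : finRotate (n + 1) (Fin.last n) = 0 := finRotate_last
  have hcast : ∀ a : Fin n, finRotate (n + 1) a.castSucc = a.succ := fun a => by
    rw [finRotate_apply, Fin.coeSucc_eq_succ]
  unfold chiSign
  rw [Fin.prod_univ_castSucc]
  have h1 : ∀ a : Fin n, (Finset.univ.filter fun b : Fin (n + 1) =>
      a.castSucc < b ∧ finRotate (n + 1) b < finRotate (n + 1) a.castSucc) = {Fin.last n} := by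
    intro a
    ext b
    simp only [Finset.mem_filter, Finset.mem_univ, true_and, Finset.mem_singleton]
    refine b.lastCases ?_ fun b => ?_
    · simp only [hlast, hcast, iff_true]
      exact ⟨Fin.castSucc_lt_last a, Fin.succ_pos a⟩
    · simp only [hcast, Fin.castSucc_lt_castSucc_iff, Fin.succ_lt_succ_iff]
      constructor
      · rintro ⟨h, h'⟩
        exact absurd h h'.asymm
      · intro h
        exact absurd h (Fin.castSucc_lt_last b).ne
  have h2 : (Finset.univ.filter fun b : Fin (n + 1) =>
      Fin.last n < b ∧ finRotate (n + 1) b < finRotate (n + 1) (Fin.last n)) = ∅ := by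
    ext b
    simp [hlast]
  rw [h2, Finset.prod_empty, mul_one]
  rw [Finset.prod_congr rfl fun a _ => by rw [h1 a, Finset.prod_singleton]]
  simp only [hlast, hcast, neg_negOnePow, negOnePow_sum]
  congr 1
  rw [Finset.sum_add_distrib, Finset.mul_sum]
  simp only [mul_comm, Finset.sum_const, Finset.card_univ, Fintype.card_fin]
  simp [add_comm]

/-- The new last index joins the complement and takes part in no inversion, so only the factor
(-1)^{|Sᶜ|} changes. -/
lemma shuffleSign_map_castSucc (d : Fin (n + 1) → ℤ) (S : Finset (Fin n)) :
    shuffleSign d (S.map Fin.castSuccEmb) = -shuffleSign (d ∘ Fin.castSucc) S := by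
  have hcard : (S.map Fin.castSuccEmb)ᶜ.card = Sᶜ.card + 1 := by
    have := S.card_le_univ
    rw [Finset.card_compl, Finset.card_compl, Finset.card_map]
    simp only [Fintype.card_fin] at *
    omega
  have hinv : inversionExponent d (S.map Fin.castSuccEmb) =
      inversionExponent (d ∘ Fin.castSucc) S := by
    unfold inversionExponent
    rw [Finset.sum_map]
    refine Finset.sum_congr rfl fun i _ => ?_
    have : ((S.map Fin.castSuccEmb)ᶜ.filter fun j => j < Fin.castSuccEmb i) =
        (Sᶜ.filter fun j => j < i).map Fin.castSuccEmb := by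
      ext j
      refine j.lastCases ?_ fun j => ?_
      · rw [Finset.mem_filter]
        simp [Fin.castSucc_ne_last, Fin.le_last]
      · rw [Finset.mem_filter]
        simp
    rw [this, Finset.sum_map]
    simp
  rw [shuffleSign_eq_negOnePow, shuffleSign_eq_negOnePow, hcard, hinv, neg_negOnePow]
  congr 1
  push_cast
  ring

lemma sum_orderEmbOfFin {A : Type*} [AddCommMonoid A] (f : Fin n → A) (S : Finset (Fin n)) :
    ∑ i, f (S.orderEmbOfFin rfl i) = ∑ i ∈ S, f i := by
  conv_rhs => rw [← S.map_orderEmbOfFin_univ rfl]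
  rw [Finset.sum_map]
  rfl

end Signs

/-! ## Symmetry of the pairing of brackets -/

section Symmetry

/-- A multilinear map evaluated on the entries of a tuple with index in `S`, in increasing order. -/
def evalOn {W Z : Type*} (g : ∀ k : ℕ, (Fin k → W) → Z) {n : ℕ} (S : Finset (Fin n))
    (v : Fin n → W) : Z :=
  g S.card (v ∘ S.orderEmbOfFin rfl)

/-- Any increasing enumeration of S may be used, which avoids casts between `Fin S.card` and `Fin
k`. -/
lemma evalOn_eq {W Z : Type*} (g : ∀ k : ℕ, (Fin k → W) → Z) {n k : ℕ} (S : Finset (Fin n))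
    (v : Fin n → W)
    (e : Fin k → Fin n) (hk : S.card = k) (he : StrictMono e) (hS : ∀ i, e i ∈ S) :
    evalOn g S v = g k (v ∘ e) := by
  subst hk
  rw [evalOn, Finset.orderEmbOfFin_unique rfl hS he]

lemma evalOn_congr {W Z : Type*} (g : ∀ k : ℕ, (Fin k → W) → Z) {n : ℕ} (S : Finset (Fin n))
    {v w : Fin n → W}
    (h : ∀ i ∈ S, v i = w i) : evalOn g S v = evalOn g S w := by
  unfold evalOn
  congr 1
  funext i
  exact h _ (Finset.orderEmbOfFin_mem _ _ i)

variable {V W Z : Type*} [AddCommGroup V] [Module ℝ V] [AddCommGroup W] [Module ℝ W]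
  [AddCommGroup Z] [Module ℝ Z]

lemma insertion_eq (g : Brackets W) (f : MultiFamily W Z) {n : ℕ} (d : Fin n → ℤ)
    (v : Fin n → W) : insertion g f d v = ∑ S : Finset (Fin n), shuffleSign d S •
      evalOn (fun k u => f (k + 1) (Fin.cons (evalOn (fun k => g k) S v) u)) Sᶜ v := rfl

/-- The classical functional with a field inserted in the first place, in terms of the pairing. -/
lemma classicalCochain_cons {gr : ℤ → Submodule ℝ V} {br : Brackets V}
    {B : V →ₗ[ℝ] V →ₗ[ℝ] ℝ} (h : ∀ n, GradedAntisymm gr (classicalCochain br B n)) {k : ℕ}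
    {d : Fin k → ℤ} {v : Fin k → V} (hv : ∀ i, v i ∈ gr (d i)) {e : ℤ} {a : V} (ha : a ∈ gr e) :
    classicalCochain br B (k + 1) (Fin.cons a v) =
      (k + e * ∑ i, d i).negOnePow • B (br k v) a := by
  have h1 := h (k + 1) (Fin.cons e d) (Fin.cons a v)
    (fun i => by refine i.cases ?_ fun i => ?_ <;> simp [ha, hv]) (finRotate (k + 1))
  rw [chiSign_finRotate] at h1
  simp only [Fin.cons_zero, Fin.cons_succ] at h1
  have h2 : (Fin.cons a v : Fin (k + 1) → V) ∘ finRotate (k + 1) = Fin.snoc v a := by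
    rw [Fin.snoc_eq_cons_rotate]
    rfl
  rw [h2] at h1
  have h3 : classicalCochain br B (k + 1) (Fin.snoc v a) = B (br k v) a := by
    simp [classicalCochain]
  -- The rotation sign now occurs twice and squares to one.
  rw [← h3, h1, smul_smul, ← Int.negOnePow_add]
  rw [Int.negOnePow_even _ ⟨_, rfl⟩, one_smul]

namespace IsCyclicLInfinity

variable {gr : ℤ → Submodule ℝ V} {br : Brackets V} {B : V →ₗ[ℝ] V →ₗ[ℝ] ℝ}

/-- Since the degree of the pairing is odd, no signs remain in its symmetry. -/
lemma comm (h : IsCyclicLInfinity gr br B) (a b : V) : B a b = B b a := by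
  have htop := h.isLInfinity.graded.submodule_iSup_eq_top
  have ha : a ∈ ⨆ d, gr d := htop ▸ Submodule.mem_top
  have hb : b ∈ ⨆ d, gr d := htop ▸ Submodule.mem_top
  induction ha using Submodule.iSup_induction' with
  | mem d a ha =>
    induction hb using Submodule.iSup_induction' with
    | mem e b hb =>
      by_cases hde : d + e = 3
      · rw [h.symm d e a b ha hb, Int.negOnePow_even, one_smul]
        obtain rfl : e = 3 - d := by omega
        rcases Int.even_or_odd d with hd | hd
        · exact hd.mul_right _
        · exact ((by decide : Odd (3 : ℤ)).sub_odd hd).mul_left _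
      · rw [h.degree d e a b ha hb hde, h.degree e d b a hb ha (by omega)]
    | zero => simp
    | add x y _ _ hx hy => rw [map_add, map_add, LinearMap.add_apply, hx, hy]
  | zero => simp
  | add x y _ _ hx hy => rw [map_add, map_add, LinearMap.add_apply, hx, hy]

lemma evalOn_mem (h : IsLInfinity gr br) {n : ℕ} {d : Fin n → ℤ} {v : Fin n → V}
    (hv : ∀ i, v i ∈ gr (d i)) (S : Finset (Fin n)) :
    evalOn (fun k => br k) S v ∈ gr (∑ i ∈ S, d i + 2 - S.card) := by
  rw [← sum_orderEmbOfFin]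
  exact h.degree _ _ _ fun i => hv _

/-- A summand of the Chevalley-Eilenberg differential of the classical functional, polarized. -/
def term (br : Brackets V) (B : V →ₗ[ℝ] V →ₗ[ℝ] ℝ) {n : ℕ} (d : Fin n → ℤ) (v w : Fin n → V)
    (S : Finset (Fin n)) : ℝ :=
  shuffleSign d S • evalOn (fun k u => classicalCochain br B (k + 1)
    (Fin.cons (evalOn (fun k => br k) S v) u)) Sᶜ w

/-- Moving the inner bracket from the first slot to the pairing slot costs the rotation sign, whose
arity part |Sᶜ| cancels the one in `shuffleSign`. -/
lemma term_eq (h : IsCyclicLInfinity gr br B) {n : ℕ} {d : Fin n → ℤ} {v w : Fin n → V}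
    (hv : ∀ i, v i ∈ gr (d i)) (hw : ∀ i, w i ∈ gr (d i)) (S : Finset (Fin n)) :
    term br B d v w S =
      (inversionExponent d S + (∑ i ∈ S, d i + 2 - S.card) * ∑ i ∈ Sᶜ, d i).negOnePow •
        B (evalOn (fun k => br k) Sᶜ w) (evalOn (fun k => br k) S v) := by
  unfold term
  conv_lhs => rw [evalOn]
  rw [classicalCochain_cons h.invariant (v := w ∘ Sᶜ.orderEmbOfFin rfl)
      (d := d ∘ Sᶜ.orderEmbOfFin rfl) (fun i => hw _)
      (evalOn_mem h.isLInfinity hv S), shuffleSign_eq_negOnePow, smul_smul, ← Int.negOnePow_add]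
  simp only [Function.comp_apply, sum_orderEmbOfFin]
  congr 1
  rw [Int.negOnePow_eq_iff]
  exact ⟨Sᶜ.card, by ring⟩

/-- Up to sign, both sides pair the same two brackets. The pairing is symmetric, and the signs agree
when the degrees of the brackets add up to 3; otherwise both sides vanish. -/
lemma term_compl (h : IsCyclicLInfinity gr br B) {n : ℕ} {d : Fin n → ℤ} {v w : Fin n → V}
    (hv : ∀ i, v i ∈ gr (d i)) (hw : ∀ i, w i ∈ gr (d i)) (S : Finset (Fin n)) :
    term br B d v w S = term br B d w v Sᶜ := by
  rw [term_eq h hv hw, term_eq h hw hv, compl_compl]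
  by_cases hd : (∑ i ∈ S, d i + 2 - (S.card : ℤ)) + (∑ i ∈ Sᶜ, d i + 2 - (Sᶜ.card : ℤ)) = 3
  · rw [h.comm]
    congr 1
    rw [Int.negOnePow_eq_iff]
    have hinv := inversionExponent_add_compl d S
    set a := ∑ i ∈ S, d i
    set b := ∑ i ∈ Sᶜ, d i
    set s : ℤ := (S.card : ℤ)
    set t : ℤ := (Sᶜ.card : ℤ)
    have ht : t = a + b + 1 - s := by linarith
    have hI : inversionExponent d S = a * b + s * t - inversionExponent d Sᶜ := by linarith
    -- After eliminating t and the inversions of S, the two exponents differ by this product up to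
    -- even terms.
    have hprod : Even ((a - s) * (a - s + 1)) := Int.even_mul_succ_self _
    obtain ⟨c, hc⟩ := hprod
    rw [hI, ht]
    exact ⟨c + s * (a + 1 - s) + a * b - inversionExponent d Sᶜ + b - a, by linear_combination hc⟩
  · have h1 := evalOn_mem h.isLInfinity hv S
    have h2 := evalOn_mem h.isLInfinity hw Sᶜ
    rw [h.degree _ _ _ _ h2 h1 (by omega), h.degree _ _ _ _ h1 h2 (by omega)]
    simp

end IsCyclicLInfinity

end Symmetry

/-! ### Derivatives of functionals along fields. -/

section MasterEquation

variable {V Z : Type*} [AddCommGroup V] [Module ℝ V] [AddCommGroup Z] [Module ℝ Z]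

/-- The derivative of a functional along the field which has the given values on the entries
with index in `S`. -/
def insertValues (f : MultiFamily V Z) {n : ℕ} (d : Fin n → ℤ) (a : Finset (Fin n) → V)
    (v : Fin n → V) : Z :=
  ∑ S : Finset (Fin n), shuffleSign d S • evalOn (fun k u => f (k + 1) (Fin.cons (a S) u)) Sᶜ v

lemma evalOn_cons_add (f : MultiFamily V Z) {n : ℕ} (S : Finset (Fin n)) (a b : V)
    (v : Fin n → V) : evalOn (fun k u => f (k + 1) (Fin.cons (a + b) u)) S v =
      evalOn (fun k u => f (k + 1) (Fin.cons a u)) S v +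
        evalOn (fun k u => f (k + 1) (Fin.cons b u)) S v :=
  (f _).cons_add _ _ _

lemma evalOn_cons_smul (f : MultiFamily V Z) {n : ℕ} (S : Finset (Fin n)) (c : ℝ) (a : V)
    (v : Fin n → V) : evalOn (fun k u => f (k + 1) (Fin.cons (c • a) u)) S v =
      c • evalOn (fun k u => f (k + 1) (Fin.cons a u)) S v :=
  (f _).cons_smul _ _ _

lemma insertValues_add (f : MultiFamily V Z) {n : ℕ} (d : Fin n → ℤ) (a b : Finset (Fin n) → V)
    (v : Fin n → V) :
    insertValues f d (a + b) v = insertValues f d a v + insertValues f d b v := by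
  simp only [insertValues, Pi.add_apply, evalOn_cons_add, smul_add, Finset.sum_add_distrib]

lemma insertValues_smul (f : MultiFamily V Z) {n : ℕ} (d : Fin n → ℤ) (c : ℝ)
    (a : Finset (Fin n) → V) (v : Fin n → V) :
    insertValues f d (c • a) v = c • insertValues f d a v := by
  simp only [insertValues, Pi.smul_apply, evalOn_cons_smul, Finset.smul_sum]
  exact Finset.sum_congr rfl fun S _ => smul_comm _ _ _

lemma insertValues_zero (f : MultiFamily V Z) {n : ℕ} (d : Fin n → ℤ) (v : Fin n → V) :
    insertValues f d 0 v = 0 := by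
  simpa using insertValues_smul f d 0 0 v

lemma insertValues_sub (f : MultiFamily V Z) {n : ℕ} (d : Fin n → ℤ) (a b : Finset (Fin n) → V)
    (v : Fin n → V) :
    insertValues f d (a - b) v = insertValues f d a v - insertValues f d b v := by
  rw [eq_sub_iff_add_eq, ← insertValues_add, sub_add_cancel]

/-! ## The classical master equation -/

namespace IsCyclicLInfinity

variable {gr : ℤ → Submodule ℝ V} {br : Brackets V} {B : V →ₗ[ℝ] V →ₗ[ℝ] ℝ}

lemma insertValues_evalOn {n : ℕ} (d : Fin n → ℤ) (v w : Fin n → V) :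
    insertValues (classicalCochain br B) d (fun S => evalOn (fun k => br k) S v) w =
      ∑ S, term br B d v w S := rfl

/-- Reindexing by complements exchanges the inner and the outer bracket: this is the symmetry of
⟨ℓ(v), ℓ(w)⟩. -/
lemma insertValues_comm (h : IsCyclicLInfinity gr br B) {n : ℕ} {d : Fin n → ℤ}
    {v w : Fin n → V} (hv : ∀ i, v i ∈ gr (d i)) (hw : ∀ i, w i ∈ gr (d i)) :
    insertValues (classicalCochain br B) d (fun S => evalOn (fun k => br k) S v) w =
      insertValues (classicalCochain br B) d (fun S => evalOn (fun k => br k) S w) v := by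
  rw [insertValues_evalOn, insertValues_evalOn]
  rw [← Equiv.sum_comp (compl_involutive (α := Finset (Fin n))).toPerm]
  exact Finset.sum_congr rfl fun S _ => by
    rw [term_compl h hv hw]
    simp

/-- When the last index is outside S, the last argument stays in the pairing slot, and what it is
paired with is a summand of the Jacobi identity for the other arguments. -/
lemma term_map_castSucc {n : ℕ} (d : Fin (n + 1) → ℤ) (v : Fin (n + 1) → V)
    (S : Finset (Fin n)) :
    term br B d v v (S.map Fin.castSuccEmb) =
      -(B (shuffleSign (d ∘ Fin.castSucc) S • evalOn (fun k u => br (k + 1)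
        (Fin.cons (evalOn (fun k => br k) S (v ∘ Fin.castSucc)) u)) Sᶜ (v ∘ Fin.castSucc))
        (v (Fin.last n))) := by
  have hcard : (S.map Fin.castSuccEmb)ᶜ.card = Sᶜ.card + 1 := by
    have := S.card_le_univ
    rw [Finset.card_compl, Finset.card_compl, Finset.card_map]
    simp only [Fintype.card_fin] at *
    omega
  have h1 : evalOn (fun k => br k) (S.map Fin.castSuccEmb) v =
      evalOn (fun k => br k) S (v ∘ Fin.castSucc) :=
    evalOn_eq _ _ _ (Fin.castSucc ∘ S.orderEmbOfFin rfl) (by simp)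
      ((Fin.strictMono_castSucc).comp (OrderEmbedding.strictMono _)) (fun i => by
        simp [Finset.orderEmbOfFin_mem])
  have h2 : ∀ a, evalOn (fun k u => classicalCochain br B (k + 1) (Fin.cons a u))
      (S.map Fin.castSuccEmb)ᶜ v =
      B (br (Sᶜ.card + 1) (Fin.cons a ((v ∘ Fin.castSucc) ∘ Sᶜ.orderEmbOfFin rfl)))
        (v (Fin.last n)) := by
    intro a
    rw [evalOn_eq _ _ v (Fin.snoc (α := fun _ => Fin (n + 1))
      (Fin.castSucc ∘ Sᶜ.orderEmbOfFin rfl) (Fin.last n)) hcard]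
    · have : (Fin.cons a (v ∘ Fin.snoc (α := fun _ => Fin (n + 1))
          (Fin.castSucc ∘ Sᶜ.orderEmbOfFin rfl) (Fin.last n)) : Fin (Sᶜ.card + 1 + 1) → V) =
          Fin.snoc (α := fun _ => V) (Fin.cons a ((v ∘ Fin.castSucc) ∘ Sᶜ.orderEmbOfFin rfl))
            (v (Fin.last n)) := by
        rw [← Fin.cons_snoc_eq_snoc_cons]
        congr 1
        funext i
        refine i.lastCases ?_ fun i => ?_ <;> simp
      rw [this]
      simp [classicalCochain]
    · intro i j hij
      revert hij
      refine j.lastCases (fun hij => ?_) fun j => ?_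
      · obtain ⟨i, rfl⟩ := Fin.exists_castSucc_eq.2 hij.ne
        simp [Fin.castSucc_lt_last]
      · refine i.lastCases (fun hij => ?_) fun i hij => ?_
        · exact absurd hij (Fin.castSucc_lt_last j).asymm
        · simpa using hij
    · intro i
      refine i.lastCases ?_ fun i => ?_
      · simp [Fin.castSucc_ne_last]
      · have := Finset.orderEmbOfFin_mem Sᶜ rfl i
        simp only [Fin.snoc_castSucc, Finset.mem_compl] at this ⊢
        simpa using this
  unfold term
  rw [shuffleSign_map_castSucc, h1, h2]
  rcases Int.units_eq_one_or (shuffleSign (d ∘ Fin.castSucc) S) with h | h <;> rw [h] <;>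
    simp [evalOn]

lemma sum_term_last_notMem (h : IsLInfinity gr br) {n : ℕ} {d : Fin (n + 1) → ℤ}
    {v : Fin (n + 1) → V} (hv : ∀ i, v i ∈ gr (d i)) :
    ∑ S ∈ Finset.univ.filter (fun S : Finset (Fin (n + 1)) => Fin.last n ∉ S),
      term br B d v v S = 0 := by
  have : Finset.univ.filter (fun S : Finset (Fin (n + 1)) => Fin.last n ∉ S) =
      Finset.univ.map (Finset.mapEmbedding Fin.castSuccEmb).toEmbedding := by
    ext S
    simp only [Finset.mem_filter, Finset.mem_univ, true_and, Finset.mem_map,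
      RelEmbedding.coe_toEmbedding, Finset.mapEmbedding_apply]
    constructor
    · intro hS
      refine ⟨Finset.univ.filter fun i => i.castSucc ∈ S, ?_⟩
      ext i
      refine i.lastCases ?_ fun i => ?_
      · simp [hS, Fin.castSucc_ne_last]
      · simp
    · rintro ⟨T, rfl⟩
      simp [Fin.castSucc_ne_last]
  rw [this, Finset.sum_map]
  simp only [RelEmbedding.coe_toEmbedding, Finset.mapEmbedding_apply, term_map_castSucc]
  rw [Finset.sum_neg_distrib, ← LinearMap.sum_apply, ← map_sum, ← insertion_eq,
    h.jacobi n (d ∘ Fin.castSucc) (v ∘ Fin.castSucc) fun i => hv _]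
  simp

/-- Complementation matches the subsets containing i with those omitting i and preserves the terms.
-/
lemma sum_term_eq (h : IsCyclicLInfinity gr br B) {n : ℕ} {d : Fin n → ℤ} {v : Fin n → V}
    (hv : ∀ i, v i ∈ gr (d i)) (i : Fin n) :
    ∑ S, term br B d v v S =
      2 * ∑ S ∈ Finset.univ.filter (fun S : Finset (Fin n) => i ∉ S), term br B d v v S := by
  rw [← Finset.sum_filter_add_sum_filter_not Finset.univ (fun S : Finset (Fin n) => i ∉ S),
    two_mul]
  congr 1
  refine Finset.sum_nbij' compl compl ?_ ?_ ?_ ?_ fun S _ => term_compl h hv hv S <;> simp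

/-- The classical functional is annihilated by the Chevalley-Eilenberg differential. -/
lemma insertValues_self (h : IsCyclicLInfinity gr br B) {n : ℕ} {d : Fin n → ℤ}
    {v : Fin n → V} (hv : ∀ i, v i ∈ gr (d i)) :
    insertValues (classicalCochain br B) d (fun S => evalOn (fun k => br k) S v) v = 0 := by
  rw [insertValues_evalOn]
  rcases n with _ | n
  -- Without arguments there is no last index to single out; the only subset is empty and
  -- contributes the bracket of arity zero.
  · refine Finset.sum_eq_zero fun S _ => ?_
    obtain rfl : S = ∅ := Finset.eq_empty_of_isEmpty S
    have : evalOn (fun k => br k) (∅ : Finset (Fin 0)) v = 0 := by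
      simp only [evalOn, Finset.card_empty, h.isLInfinity.uncurved]
      rfl
    rw [term, this]
    simp only [evalOn]
    rw [(classicalCochain br B _).map_coord_zero 0 (by simp), smul_zero]
  · rw [sum_term_eq h hv (Fin.last n), sum_term_last_notMem h.isLInfinity hv, mul_zero]

/-- Half of a vanishing sum, now for an arbitrary index i. Taking u in slot i and X elsewhere, only
the terms whose inner bracket is built from X alone remain. -/
lemma sum_term_notMem (h : IsCyclicLInfinity gr br B) {n : ℕ} {d : Fin n → ℤ} {v : Fin n → V}
    (hv : ∀ i, v i ∈ gr (d i)) (i : Fin n) :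
    ∑ S ∈ Finset.univ.filter (fun S : Finset (Fin n) => i ∉ S), term br B d v v S = 0 := by
  have h1 := insertValues_self h hv
  rw [insertValues_evalOn, sum_term_eq h hv i] at h1
  linarith

end IsCyclicLInfinity

end MasterEquation

/-! ## The equivariant lift -/

section Lift

variable {V Z Z' : Type*} [AddCommGroup V] [Module ℝ V] [AddCommGroup Z] [Module ℝ Z]
  [AddCommGroup Z'] [Module ℝ Z']

/-- The polarization of `(X, u) ↦ f(X + u) - f(X) - f'(X) u`. -/
def equivariantLift {k : ℕ} (f : MultilinearMap ℝ (fun _ : Fin k => V) Z) :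
    MultilinearMap ℝ (fun _ : Fin k => V × V) Z :=
  f.compLinearMap (fun _ => LinearMap.fst ℝ V V + LinearMap.snd ℝ V V) -
    f.compLinearMap (fun _ => LinearMap.fst ℝ V V) -
    ∑ i : Fin k, f.compLinearMap
      (fun j => if j = i then LinearMap.snd ℝ V V else LinearMap.fst ℝ V V)

/-- The polarization of `(X, u) ↦ f(X + u) - f(X) - f(u) - f'(X) u`. -/
def actionLift {k : ℕ} (f : MultilinearMap ℝ (fun _ : Fin k => V) Z) :
    MultilinearMap ℝ (fun _ : Fin k => V × V) Z :=
  equivariantLift f - f.compLinearMap (fun _ => LinearMap.snd ℝ V V)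

lemma equivariantLift_apply {k : ℕ} (f : MultilinearMap ℝ (fun _ : Fin k => V) Z)
    (p : Fin k → V × V) :
    equivariantLift f p = f (fun i => (p i).1 + (p i).2) - f (fun i => (p i).1) -
      ∑ i, f (Function.update (fun j => (p j).1) i (p i).2) := by
  simp only [equivariantLift, sub_apply, sum_apply,
    MultilinearMap.compLinearMap_apply, LinearMap.add_apply, LinearMap.fst_apply,
    LinearMap.snd_apply]
  congr 1
  refine Finset.sum_congr rfl fun i _ => ?_
  congr 1
  funext j
  by_cases hj : j = i
  · subst hj
    simp
  · simp [hj]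

lemma actionLift_apply {k : ℕ} (f : MultilinearMap ℝ (fun _ : Fin k => V) Z)
    (p : Fin k → V × V) :
    actionLift f p = equivariantLift f p - f (fun i => (p i).2) := rfl

lemma infAdjoint_fst (br : Brackets V) {k : ℕ} (p : Fin k → V × V) :
    (infAdjoint br k p).1 = br k (fun i => (p i).1) := rfl

/-- The infinity adjoint action is the direct sum of two copies of the algebra, in the coordinates
`(X, X + u)`. -/
lemma infAdjoint_snd (br : Brackets V) {k : ℕ} (p : Fin k → V × V) :
    (infAdjoint br k p).2 = br k (fun i => (p i).1 + (p i).2) - br k (fun i => (p i).1) := by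
  have h1 := (br k).map_add_univ (fun i => (p i).1) (fun i => (p i).2)
  rw [show (fun i => (p i).1 + (p i).2) = (fun i => (p i).1) + fun i => (p i).2 from rfl, h1,
    ← Finset.sum_erase_add _ _ (Finset.mem_univ (Finset.univ : Finset (Fin k))),
    Finset.piecewise_univ, add_sub_cancel_right]
  simp only [infAdjoint, MultilinearMap.prod_apply, sum_apply,
    MultilinearMap.compLinearMap_apply]
  refine Finset.sum_congr ?_ fun A _ => ?_
  · simp [Finset.ssubsets]
  · congr 1
    funext i
    by_cases hi : i ∈ A <;> simp [hi]

/-- In the linear term f'(X)u the distinguished slot is either the inserted one, which then carries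
b, or a slot from S, with a inserted. -/
lemma evalOn_equivariantLift (f : MultiFamily V Z) {n : ℕ} (S : Finset (Fin n)) (a b : V)
    (p : Fin n → V × V) :
    evalOn (fun k q => equivariantLift (f (k + 1)) (Fin.cons (a, b) q)) S p =
      evalOn (fun k u => f (k + 1) (Fin.cons (a + b) u)) S (fun i => (p i).1 + (p i).2) -
      evalOn (fun k u => f (k + 1) (Fin.cons a u)) S (fun i => (p i).1) -
      (evalOn (fun k u => f (k + 1) (Fin.cons b u)) S (fun i => (p i).1) +
        ∑ i ∈ S, evalOn (fun k u => f (k + 1) (Fin.cons a u)) S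
          (Function.update (fun j => (p j).1) i (p i).2)) := by
  have hc : ∀ (φ : V × V → V), (fun i => φ ((Fin.cons (a, b) (p ∘ S.orderEmbOfFin rfl) :
      Fin (S.card + 1) → V × V) i)) =
      Fin.cons (φ (a, b)) ((fun i => φ (p i)) ∘ S.orderEmbOfFin rfl) := by
    intro φ
    funext i
    refine i.cases ?_ fun i => ?_ <;> simp
  rw [← sum_orderEmbOfFin]
  simp only [evalOn]
  rw [equivariantLift_apply, hc (fun q => q.1 + q.2), hc Prod.fst, Fin.sum_univ_succ]
  congr 2
  · simp
  · refine Finset.sum_congr rfl fun i _ => ?_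
    rw [← Fin.cons_update, Fin.cons_succ,
      Function.update_comp_eq_of_injective _ (S.orderEmbOfFin rfl).injective]
    rfl

lemma evalOn_actionLift (f : MultiFamily V Z) {n : ℕ} (S : Finset (Fin n)) (a b : V)
    (p : Fin n → V × V) :
    evalOn (fun k q => actionLift (f (k + 1)) (Fin.cons (a, b) q)) S p =
      evalOn (fun k q => equivariantLift (f (k + 1)) (Fin.cons (a, b) q)) S p -
      evalOn (fun k u => f (k + 1) (Fin.cons b u)) S (fun i => (p i).2) := by
  simp only [evalOn, actionLift_apply]
  congr 2
  funext i
  refine i.cases ?_ fun i => ?_ <;> simp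

/-- Derivatives of the lift of a functional. -/
lemma insertion_equivariantLift (g : Brackets (V × V)) (f : MultiFamily V Z) {n : ℕ}
    (d : Fin n → ℤ) (p : Fin n → V × V) {a b : Finset (Fin n) → V}
    (hab : ∀ S, evalOn (fun k => g k) S p = (a S, b S)) :
    insertion g (fun k => equivariantLift (f k)) d p =
      insertValues f d (a + b) (fun i => (p i).1 + (p i).2) -
      insertValues f d a (fun i => (p i).1) - insertValues f d b (fun i => (p i).1) -
      ∑ i, ∑ S ∈ Finset.univ.filter (fun S : Finset (Fin n) => i ∉ S), shuffleSign d S •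
        evalOn (fun k u => f (k + 1) (Fin.cons (a S) u)) Sᶜ
          (Function.update (fun j => (p j).1) i (p i).2) := by
  -- For each S the slot of u runs over Sᶜ. Summing over that slot last isolates, for each i, the
  -- subsets omitting i, as `sum_term_notMem` requires.
  have hswap : ∀ t : Finset (Fin n) → Fin n → Z,
      ∑ i, ∑ S ∈ Finset.univ.filter (fun S : Finset (Fin n) => i ∉ S), t S i =
        ∑ S, ∑ i ∈ Sᶜ, t S i := by
    intro t
    simp only [Finset.sum_filter]
    rw [Finset.sum_comm]
    refine Finset.sum_congr rfl fun S _ => ?_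
    rw [← Finset.sum_filter]
    congr 1
    ext i
    simp
  rw [hswap, insertion_eq]
  simp only [insertValues, ← Finset.sum_sub_distrib]
  refine Finset.sum_congr rfl fun S _ => ?_
  rw [hab, evalOn_equivariantLift, ← Finset.smul_sum]
  simp only [smul_sub, smul_add, Pi.add_apply]
  abel

lemma insertion_actionLift (g : Brackets (V × V)) (f : MultiFamily V Z) {n : ℕ}
    (d : Fin n → ℤ) (p : Fin n → V × V) {a b : Finset (Fin n) → V}
    (hab : ∀ S, evalOn (fun k => g k) S p = (a S, b S)) :
    insertion g (fun k => actionLift (f k)) d p =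
      insertion g (fun k => equivariantLift (f k)) d p -
        insertValues f d b (fun i => (p i).2) := by
  rw [insertion_eq, insertion_eq]
  simp only [insertValues, ← Finset.sum_sub_distrib]
  refine Finset.sum_congr rfl fun S _ => ?_
  rw [hab, evalOn_actionLift, smul_sub]

end Lift

/-! ## The infinity adjoint action -/

section Adjoint

variable {V Z : Type*} [AddCommGroup V] [Module ℝ V] [AddCommGroup Z] [Module ℝ Z]

lemma isInternal_sumGr {L M : Type*} [AddCommGroup L] [Module ℝ L] [AddCommGroup M] [Module ℝ M]
    {grL : ℤ → Submodule ℝ L} {grM : ℤ → Submodule ℝ M} (hL : DirectSum.IsInternal grL)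
    (hM : DirectSum.IsInternal grM) : DirectSum.IsInternal (sumGr grL grM) := by
  rw [DirectSum.isInternal_submodule_iff_iSupIndep_and_iSup_eq_top] at *
  simp only [iSupIndep_iff_finsetSum_eq_zero_imp_eq_zero] at *
  refine ⟨fun s v hv h0 i hi => ?_, ?_⟩
  · rw [Prod.ext_iff, Prod.fst_sum, Prod.snd_sum] at h0
    exact Prod.ext (hL.1 s (fun i => (v i).1) (fun i hi => (hv i hi).1) h0.1 i hi)
      (hM.1 s (fun i => (v i).2) (fun i hi => (hv i hi).2) h0.2 i hi)
  · have h1 : (⨆ d, grL d) ≤ (⨆ d, sumGr grL grM d).comap (LinearMap.inl ℝ L M) :=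
      iSup_le fun d a ha => Submodule.mem_iSup_of_mem d ⟨ha, (grM d).zero_mem⟩
    have h2 : (⨆ d, grM d) ≤ (⨆ d, sumGr grL grM d).comap (LinearMap.inr ℝ L M) :=
      iSup_le fun d a ha => Submodule.mem_iSup_of_mem d ⟨(grL d).zero_mem, ha⟩
    rw [hL.2] at h1
    rw [hM.2] at h2
    rw [eq_top_iff]
    rintro ⟨a, b⟩ -
    have ha : LinearMap.inl ℝ L M a ∈ ⨆ d, sumGr grL grM d := h1 trivial
    have hb : LinearMap.inr ℝ L M b ∈ ⨆ d, sumGr grL grM d := h2 trivial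
    simpa using Submodule.add_mem _ ha hb

lemma map_zero_of_uncurved {f : MultiFamily V Z} (h0 : f 0 = 0) (k : ℕ) :
    f k (fun _ => 0) = 0 := by
  rcases k with _ | k
  · rw [h0]
    rfl
  · exact (f _).map_coord_zero 0 rfl

lemma evalOn_infAdjoint (br : Brackets V) {n : ℕ} (p : Fin n → V × V) (S : Finset (Fin n)) :
    evalOn (fun k => infAdjoint br k) S p = (evalOn (fun k => br k) S (fun i => (p i).1),
      evalOn (fun k => br k) S (fun i => (p i).1 + (p i).2) -
        evalOn (fun k => br k) S (fun i => (p i).1)) :=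
  Prod.ext (infAdjoint_fst _ _) (infAdjoint_snd _ _)

variable {gr : ℤ → Submodule ℝ V} {br : Brackets V}

/-- An inner bracket with components (a, c - a) has a + (c - a) = c, so composing brackets keeps the
coordinates X and X + u separate. -/
lemma insertion_infAdjoint (n : ℕ) (d : Fin n → ℤ) (p : Fin n → V × V) :
    insertion (infAdjoint br) (infAdjoint br) d p =
      (insertion br br d (fun i => (p i).1),
        insertion br br d (fun i => (p i).1 + (p i).2) - insertion br br d (fun i => (p i).1)) := by
  simp only [insertion_eq]
  have h1 : ∀ S : Finset (Fin n), evalOn (fun k u => infAdjoint br (k + 1)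
      (Fin.cons (evalOn (fun k => infAdjoint br k) S p) u)) Sᶜ p =
      (evalOn (fun k u => br (k + 1)
        (Fin.cons (evalOn (fun k => br k) S (fun i => (p i).1)) u)) Sᶜ (fun i => (p i).1),
       evalOn (fun k u => br (k + 1)
        (Fin.cons (evalOn (fun k => br k) S (fun i => (p i).1 + (p i).2)) u)) Sᶜ
          (fun i => (p i).1 + (p i).2) -
       evalOn (fun k u => br (k + 1)
        (Fin.cons (evalOn (fun k => br k) S (fun i => (p i).1)) u)) Sᶜ (fun i => (p i).1)) := by
    intro S
    rw [evalOn_infAdjoint]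
    set a := evalOn (fun k => br k) S (fun i => (p i).1)
    set c := evalOn (fun k => br k) S (fun i => (p i).1 + (p i).2)
    have hc : ∀ (φ : V × V → V), (fun i => φ ((Fin.cons (a, c - a) (p ∘ Sᶜ.orderEmbOfFin rfl) :
        Fin (Sᶜ.card + 1) → V × V) i)) =
        Fin.cons (φ (a, c - a)) ((fun i => φ (p i)) ∘ Sᶜ.orderEmbOfFin rfl) := by
      intro φ
      funext i
      refine i.cases ?_ fun i => ?_ <;> simp
    refine Prod.ext ?_ ?_
    · simp only [evalOn]
      rw [infAdjoint_fst, hc Prod.fst]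
    · simp only [evalOn]
      rw [infAdjoint_snd, hc Prod.fst, hc (fun q => q.1 + q.2), add_sub_cancel]
  simp only [h1]
  refine Prod.ext ?_ ?_
  · rw [Prod.fst_sum]
    rfl
  · rw [Prod.snd_sum, ← Finset.sum_sub_distrib]
    simp only [← smul_sub]
    rfl

/-- Each axiom is the given one at X and at X + u, which is homogeneous of the same degree. For the
inclusion, X = 0 kills the subtracted bracket, in arity zero because the algebra is uncurved. -/
theorem IsLInfinity.infAdjoint_isAction (h : IsLInfinity gr br) :
    IsAction gr br gr br (infAdjoint br) where
  isLInfinity :=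
    { graded := isInternal_sumGr h.graded h.graded
      uncurved := by
        refine MultilinearMap.ext fun p => Prod.ext ?_ ?_
        · rw [infAdjoint_fst, h.uncurved]
          rfl
        · rw [infAdjoint_snd, h.uncurved]
          simp
      degree := fun k d p hp =>
        ⟨h.degree k d _ fun i => (hp i).1, by
          rw [infAdjoint_snd]
          exact Submodule.sub_mem _ (h.degree k d _ fun i => Submodule.add_mem _ (hp i).1 (hp i).2)
            (h.degree k d _ fun i => (hp i).1)⟩
      antisymm := fun k d p hp σ => by
        refine Prod.ext ?_ ?_
        · exact h.antisymm k d _ (fun i => (hp i).1) σ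
        · have h1 := h.antisymm k d (fun i => (p i).1) (fun i => (hp i).1) σ
          have h2 := h.antisymm k d (fun i => (p i).1 + (p i).2)
            (fun i => Submodule.add_mem _ (hp i).1 (hp i).2) σ
          rw [Prod.smul_snd, infAdjoint_snd, infAdjoint_snd, smul_sub, ← h1, ← h2]
          rfl
      jacobi := fun n d p hp => by
        rw [insertion_infAdjoint, h.jacobi n d _ fun i => (hp i).1,
          h.jacobi n d _ fun i => Submodule.add_mem _ (hp i).1 (hp i).2, sub_zero]
        rfl }
  incl := fun k m => by
    refine Prod.ext ?_ ?_
    · rw [infAdjoint_fst]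
      exact map_zero_of_uncurved h.uncurved k
    · rw [infAdjoint_snd, map_zero_of_uncurved h.uncurved k]
      simp
  proj := fun _ _ => rfl

variable {B : V →ₗ[ℝ] V →ₗ[ℝ] ℝ}

lemma classicalCochain_succ (br : Brackets V) (B : V →ₗ[ℝ] V →ₗ[ℝ] ℝ) (k : ℕ)
    (v : Fin (k + 1) → V) :
    classicalCochain br B (k + 1) v = B (br k (fun i => v i.castSucc)) (v (Fin.last k)) := rfl

/-- The difference ℓ(X + u) - ℓ(X) is treated in two halves: invariance at X + u handles the first,
and invariance with X in all slots but that of the last argument handles the second. -/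
theorem IsCyclicLInfinity.infAdjoint_isCompatible (h : IsCyclicLInfinity gr br B) :
    IsCompatible gr gr (infAdjoint br) B := by
  intro k d p σ hp hlast hσ
  have h1 := h.invariant (k + 1) d (fun i => (p i).1 + (p i).2)
    (fun i => Submodule.add_mem _ (hp i).1 (hp i).2) σ
  have h2 := h.invariant (k + 1) d
    (fun i => if i = Fin.last k then (p i).2 else (p i).1)
    (fun i => by
      split_ifs
      exacts [(hp i).2, (hp i).1]) σ
  simp only [classicalCochain_succ, Function.comp_apply, hlast, hσ, zero_add] at h1 h2
  rw [infAdjoint_snd, infAdjoint_snd, map_sub, map_sub, LinearMap.sub_apply, LinearMap.sub_apply,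
    smul_sub, ← h1]
  congr 1
  simp only [Fin.castSucc_ne_last, if_true, if_false] at h2
  by_cases hs : σ (Fin.last k) = Fin.last k
  · have : ∀ i : Fin k, σ i.castSucc ≠ Fin.last k := fun i hi =>
      Fin.castSucc_ne_last i (σ.injective (hi.trans hs.symm))
    simpa only [this, hs, if_true, if_false] using h2
  -- If the permutation moves the last argument, each side has an argument with zero X-component
  -- inside ℓ(X), so both vanish.
  · obtain ⟨i, hi⟩ := Fin.exists_castSucc_eq.2 hs
    have hs' : σ.symm (Fin.last k) ≠ Fin.last k := fun h' =>
      hs (by rw [← h', σ.apply_symm_apply, h'])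
    obtain ⟨j, hj⟩ := Fin.exists_castSucc_eq.2 hs'
    rw [(br k).map_coord_zero j (by rw [hj, σ.apply_symm_apply, hlast]),
      (br k).map_coord_zero i (by rw [hi, hσ])]
    simp

/-! ## Lifts of cochains -/

lemma GradedAntisymm.equivariantLift {k : ℕ} {f : MultilinearMap ℝ (fun _ : Fin k => V) Z}
    (hf : GradedAntisymm gr f) : GradedAntisymm (sumGr gr gr) (equivariantLift f) := by
  intro d p hp σ
  have h1 := hf d (fun i => (p i).1 + (p i).2) (fun i => Submodule.add_mem _ (hp i).1 (hp i).2) σ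
  have h2 := hf d (fun i => (p i).1) (fun i => (hp i).1) σ
  rw [equivariantLift_apply, equivariantLift_apply, smul_sub, smul_sub, ← h1, ← h2,
    Finset.smul_sum]
  congr 1
  -- The permutation moves the slot occupied by u, so the sum over slots is reindexed.
  conv_rhs => rw [← Equiv.sum_comp σ]
  refine Finset.sum_congr rfl fun i _ => ?_
  rw [← hf d _ _ σ, Function.update_comp_eq_of_injective _ σ.injective]
  · rfl
  · intro j
    by_cases hj : j = σ i
    · subst hj
      simpa using (hp _).2
    · simpa [hj] using (hp _).1

lemma GradedAntisymm.snd {k : ℕ} {f : MultilinearMap ℝ (fun _ : Fin k => V) Z}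
    (hf : GradedAntisymm gr f) :
    GradedAntisymm (sumGr gr gr) (f.compLinearMap fun _ => LinearMap.snd ℝ V V) :=
  fun d p hp σ => hf d (fun i => (p i).2) (fun i => (hp i).2) σ

/-- At X = 0 the linear term has zeros in all slots but one, so it could survive only in arity one.
-/
lemma equivariantLift_zero_fst {f : MultiFamily V Z} (h0 : f 0 = 0) (h1 : f 1 = 0) (n : ℕ)
    (m : Fin n → V) : equivariantLift (f n) (fun i => (0, m i)) = f n m := by
  rw [equivariantLift_apply]
  simp only [zero_add, map_zero_of_uncurved h0, sub_zero]
  rw [sub_eq_self]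
  refine Finset.sum_eq_zero fun i _ => ?_
  rcases n with _ | _ | n
  · exact i.elim0
  · rw [h1]
    rfl
  · obtain ⟨j, hj⟩ := exists_ne i
    exact (f _).map_coord_zero j (by simp [hj])

lemma actionLift_zero_fst {f : MultiFamily V Z} (h0 : f 0 = 0) (h1 : f 1 = 0) (n : ℕ)
    (m : Fin n → V) : actionLift (f n) (fun i => (0, m i)) = 0 := by
  rw [actionLift_apply, equivariantLift_zero_fst h0 h1, sub_self]

lemma actionLift_zero_snd {f : MultiFamily V Z} (h0 : f 0 = 0) (n : ℕ) (X : Fin n → V) :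
    actionLift (f n) (fun i => (X i, 0)) = 0 := by
  rw [actionLift_apply, equivariantLift_apply]
  simp only [add_zero, sub_self, map_zero_of_uncurved h0, sub_zero, zero_sub, neg_eq_zero]
  exact Finset.sum_eq_zero fun i _ => (f _).map_coord_zero i (by simp)

lemma classicalCochain_one (h : IsLInfinity gr br) (B : V →ₗ[ℝ] V →ₗ[ℝ] ℝ) :
    classicalCochain br B 1 = 0 := by
  refine MultilinearMap.ext fun v => ?_
  rw [classicalCochain_succ, h.uncurved]
  simp

/-- The last argument has X-component zero, which kills S(X) and every linear term except the one
with u in the pairing slot; that one gives -⟨ℓ(X), m⟩. -/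
lemma equivariantLift_classicalCochain_snoc (br : Brackets V) (B : V →ₗ[ℝ] V →ₗ[ℝ] ℝ) (n : ℕ)
    (p : Fin n → V × V) (m : V) :
    equivariantLift (classicalCochain br B (n + 1)) (Fin.snoc (α := fun _ => V × V) p (0, m)) =
      B (br n (fun i => (p i).1 + (p i).2) - br n (fun i => (p i).1)) m := by
  rw [equivariantLift_apply, Fin.sum_univ_castSucc, Finset.sum_eq_zero]
  · simp [classicalCochain_succ, Function.update_of_ne, Fin.castSucc_ne_last]
  · intro i _
    rw [classicalCochain_succ, Function.update_of_ne (Fin.castSucc_ne_last i).symm]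
    simp

/-- The vector field of the equivariant action. -/
def equivariantVF (br : Brackets V) : MultiFamily (V × V) V := fun k =>
  (LinearMap.snd ℝ V V).compMultilinearMap (infAdjoint br k)

lemma isHamiltonianVF_equivariantLift (br : Brackets V) (B : V →ₗ[ℝ] V →ₗ[ℝ] ℝ) :
    IsHamiltonianVF B (fun k => equivariantLift (classicalCochain br B k)) (equivariantVF br) := by
  intro n p m
  rw [equivariantLift_classicalCochain_snoc]
  simp only [equivariantVF, LinearMap.compMultilinearMap_apply, LinearMap.snd_apply,
    infAdjoint_snd]

lemma isHamiltonianVF_actionLift (br : Brackets V) (B : V →ₗ[ℝ] V →ₗ[ℝ] ℝ) :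
    IsHamiltonianVF B (fun k => actionLift (classicalCochain br B k))
      (actionVF br (infAdjoint br)) := by
  intro n p m
  have h1 := isHamiltonianVF_equivariantLift br B n p m
  dsimp only at h1
  rw [actionLift_apply, h1]
  simp [classicalCochain_succ, equivariantVF, actionVF]

/-! ## The equivariant master equation -/

namespace IsCyclicLInfinity

lemma isRedCochain_degree (h : IsCyclicLInfinity gr br B) (n : ℕ) (d : Fin n → ℤ)
    (v : Fin n → V) (hv : ∀ i, v i ∈ gr (d i)) (hd : ∑ i, (d i - 1) ≠ 0) :
    classicalCochain br B n v = 0 := by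
  rcases n with _ | n
  · rfl
  · rw [classicalCochain_succ]
    refine h.degree _ _ _ _ (h.isLInfinity.degree n (fun i => d i.castSucc) _ fun i => hv _)
      (hv (Fin.last n)) fun h' => hd ?_
    rw [Finset.sum_sub_distrib, Fin.sum_univ_castSucc]
    simp
    linarith

lemma equivariantLift_degree (h : IsCyclicLInfinity gr br B) (n : ℕ) (d : Fin n → ℤ)
    (p : Fin n → V × V) (hp : ∀ i, p i ∈ sumGr gr gr (d i)) (hd : ∑ i, (d i - 1) ≠ 0) :
    equivariantLift (classicalCochain br B n) p = 0 := by
  rw [equivariantLift_apply,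
    h.isRedCochain_degree n d _ (fun i => Submodule.add_mem _ (hp i).1 (hp i).2) hd,
    h.isRedCochain_degree n d _ (fun i => (hp i).1) hd, Finset.sum_eq_zero, sub_zero, sub_zero]
  refine fun i _ => h.isRedCochain_degree n d _ (fun j => ?_) hd
  by_cases hj : j = i
  · subst hj
    simpa using (hp _).2
  · simpa [hj] using (hp _).1

/-- The terms of the derivative along `ℓ(X)` which are linear in `u` cancel. -/
lemma sum_update_eq_zero (h : IsCyclicLInfinity gr br B) {n : ℕ} {d : Fin n → ℤ}
    {p : Fin n → V × V} (hp : ∀ i, p i ∈ sumGr gr gr (d i)) :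
    ∑ i, ∑ S ∈ Finset.univ.filter (fun S : Finset (Fin n) => i ∉ S), shuffleSign d S •
      evalOn (fun k u => classicalCochain br B (k + 1)
        (Fin.cons (evalOn (fun k => br k) S (fun i => (p i).1)) u)) Sᶜ
          (Function.update (fun j => (p j).1) i (p i).2) = 0 := by
  refine Finset.sum_eq_zero fun i _ => ?_
  rw [← h.sum_term_notMem (d := d) (v := Function.update (fun j => (p j).1) i (p i).2) ?_ i]
  · refine Finset.sum_congr rfl fun S hS => ?_
    rw [term, evalOn_congr (fun k => br k) S (v := Function.update _ _ _)
      (w := fun i => (p i).1)]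
    intro j hj
    rw [Function.update_of_ne]
    rintro rfl
    exact (Finset.mem_filter.1 hS).2 hj
  · intro j
    by_cases hj : j = i
    · subst hj
      simpa using (hp _).2
    · simpa [hj] using (hp _).1

lemma sum_notMem_zero {n : ℕ} (d : Fin n → ℤ) (v : Fin n → Fin n → V) (f : MultiFamily V Z) :
    ∑ i, ∑ S ∈ Finset.univ.filter (fun S : Finset (Fin n) => i ∉ S), shuffleSign d S •
      evalOn (fun k u => f (k + 1) (Fin.cons 0 u)) Sᶜ (v i) = 0 := by
  refine Finset.sum_eq_zero fun i _ => Finset.sum_eq_zero fun S _ => ?_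
  simp only [evalOn]
  rw [(f _).map_coord_zero 0 (by simp), smul_zero]

/-- Let (v, w) be the derivative of S at w along ℓ(v), with w = X + u below. The differential gives
(X, w) - (X, X) and a linear term that cancels. The bracket, along ℓ(w) - ℓ(X), gives (w, w) - (X,
w) - (w, X) + (X, X). Symmetry and vanishing on the diagonal finish. -/
theorem isMaurerCartan_equivariantLift (h : IsCyclicLInfinity gr br B) :
    IsMaurerCartan (sumGr gr gr) (sumBr br 0) B
      (fun k => equivariantLift (classicalCochain br B k)) := by
  refine ⟨equivariantVF br, isHamiltonianVF_equivariantLift br B, fun n d p hp => ?_⟩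
  set X : Fin n → V := fun i => (p i).1
  set w : Fin n → V := fun i => (p i).1 + (p i).2
  have hX : ∀ i, X i ∈ gr (d i) := fun i => (hp i).1
  have hw : ∀ i, w i ∈ gr (d i) := fun i => Submodule.add_mem _ (hp i).1 (hp i).2
  have hY : ∀ S : Finset (Fin n), evalOn (fun k => (LinearMap.inr ℝ V V).compMultilinearMap
      (equivariantVF br k)) S p = ((0 : Finset (Fin n) → V) S,
      ((fun S => evalOn (fun k => br k) S w) - fun S => evalOn (fun k => br k) S X) S) :=
    fun S => Prod.ext rfl (infAdjoint_snd _ _)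
  rw [alongM, insertion_equivariantLift (sumBr br 0) _ d p
      (a := fun S => evalOn (fun k => br k) S X) (b := 0) fun S => rfl,
    insertion_equivariantLift _ _ d p hY, h.sum_update_eq_zero hp]
  simp only [Pi.zero_apply, sum_notMem_zero, insertValues_zero, insertValues_sub, add_zero,
    zero_add]
  rw [h.insertValues_self hX, h.insertValues_self hw, h.insertValues_comm hw hX]
  ring

/-- In the same notation the differential leaves (X, w) + (u, w) - (u, X), and the bracket, along
ℓ(w) - ℓ(X) - ℓ(u), is -2 times this. -/
theorem isMaurerCartan_actionLift (h : IsCyclicLInfinity gr br B) :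
    IsMaurerCartan (sumGr gr gr) (sumBr br br) B
      (fun k => actionLift (classicalCochain br B k)) := by
  refine ⟨actionVF br (infAdjoint br), isHamiltonianVF_actionLift br B, fun n d p hp => ?_⟩
  set X : Fin n → V := fun i => (p i).1
  set u : Fin n → V := fun i => (p i).2
  set w : Fin n → V := fun i => (p i).1 + (p i).2
  have hX : ∀ i, X i ∈ gr (d i) := fun i => (hp i).1
  have hu : ∀ i, u i ∈ gr (d i) := fun i => (hp i).2
  have hw : ∀ i, w i ∈ gr (d i) := fun i => Submodule.add_mem _ (hp i).1 (hp i).2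
  have hq : ∀ S : Finset (Fin n), evalOn (fun k => sumBr br br k) S p =
      (evalOn (fun k => br k) S X, evalOn (fun k => br k) S u) := fun S => rfl
  have hY : ∀ S : Finset (Fin n), evalOn (fun k => (LinearMap.inr ℝ V V).compMultilinearMap
      (actionVF br (infAdjoint br) k)) S p = ((0 : Finset (Fin n) → V) S,
      (((fun S => evalOn (fun k => br k) S w) - fun S => evalOn (fun k => br k) S X) -
        fun S => evalOn (fun k => br k) S u) S) := fun S =>
    Prod.ext rfl (congrArg (fun t => t - evalOn (fun k => br k) S u) (infAdjoint_snd _ _))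
  rw [alongM, insertion_actionLift _ _ d p hq, insertion_actionLift _ _ d p hY,
    insertion_equivariantLift _ _ d p hq, insertion_equivariantLift _ _ d p hY,
    h.sum_update_eq_zero hp]
  simp only [Pi.zero_apply, sum_notMem_zero, insertValues_zero, insertValues_sub,
    insertValues_add, zero_add]
  rw [h.insertValues_self hX, h.insertValues_self hw, h.insertValues_self hu,
    h.insertValues_comm hw hX, h.insertValues_comm hu hX, h.insertValues_comm hw hu]
  ring

theorem isHamiltonianBy_actionLift (h : IsCyclicLInfinity gr br B) :
    IsHamiltonianBy gr br gr br B (infAdjoint br)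
      (fun k => actionLift (classicalCochain br B k)) where
  isHam :=
    { isRedCochain :=
        { reduced := by
            refine MultilinearMap.ext fun p => ?_
            simp [actionLift_apply, equivariantLift_apply, classicalCochain]
          antisymm := fun n d p hp σ => by
            rw [actionLift_apply, actionLift_apply, smul_sub,
              (h.invariant n).equivariantLift d p hp σ]
            congr 1
            exact (h.invariant n).snd d p hp σ
          degree := fun n d p hp hd => by
            replace hd : ∑ i, (d i - 1) ≠ 0 := by simpa using hd
            rw [actionLift_apply, h.equivariantLift_degree n d p hp hd,
              h.isRedCochain_degree n d _ (fun i => (hp i).2) hd, sub_zero] }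
      restrict := actionLift_zero_fst rfl (classicalCochain_one h.isLInfinity B) }
  maurerCartan := h.isMaurerCartan_actionLift
  encodes := isHamiltonianVF_actionLift br B
  naive := actionLift_zero_snd rfl

lemma eval_eq_classicalAction (h : IsCyclicLInfinity gr br B) {F : Cochain (V × V)}
    (hF : ∀ (n : ℕ) (m : Fin n → V), F n (fun i => (0, m i)) = classicalCochain br B n m)
    (hfin : ∃ N, ∀ k, N < k → br k = 0) (α : V) :
    F.eval (0, α) = classicalAction br B α := by
  obtain ⟨N, hN⟩ := hfin
  unfold Cochain.eval classicalAction
  simp only [hF]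
  -- The functional of arity k + 1 contains the bracket of arity k, hence the shifted bound; the
  -- functional of arity zero is split off and vanishes.
  rw [finsum_eq_sum_of_support_subset (s := Finset.range (N + 2)),
    finsum_eq_sum_of_support_subset (s := Finset.range (N + 1)), Finset.sum_range_succ']
  · have h0 : classicalCochain br B 0 (fun _ => α) = 0 := rfl
    rw [h0, mul_zero, add_zero]
    refine Finset.sum_congr rfl fun k _ => ?_
    rw [classicalCochain_succ, h.comm]
    split_ifs with hk
    · rfl
    · obtain rfl : k = 0 := by omega
      rw [h.isLInfinity.uncurved]
      simp
  · intro k hk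
    by_contra hk'
    apply hk
    dsimp only
    rw [hN k (by simpa using hk')]
    simp
  · intro k hk
    by_contra hk'
    apply hk
    obtain ⟨j, rfl⟩ : ∃ j, k = j + 1 := ⟨k - 1, by
      have : ¬ k < N + 2 := by simpa using hk'
      omega⟩
    have : N < j := by
      have : ¬ j + 1 < N + 2 := by simpa using hk'
      omega
    dsimp only
    rw [classicalCochain_succ, hN j this]
    simp

lemma totalCochain_actionLift (br : Brackets V) (B : V →ₗ[ℝ] V →ₗ[ℝ] ℝ) :
    totalCochain br B (fun k => actionLift (classicalCochain br B k)) =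
      fun k => equivariantLift (classicalCochain br B k) :=
  funext fun _ => sub_add_cancel _ _

theorem isEquivariantAction (h : IsCyclicLInfinity gr br B) :
    IsEquivariantAction gr br gr br B
      (totalCochain br B fun k => actionLift (classicalCochain br B k)) := by
  rw [totalCochain_actionLift]
  have hr := equivariantLift_zero_fst (f := classicalCochain br B) rfl
    (classicalCochain_one h.isLInfinity B)
  exact
    { isRedCochain :=
        { reduced := by
            refine MultilinearMap.ext fun p => ?_
            simp [equivariantLift_apply, classicalCochain]
          antisymm := fun n => (h.invariant n).equivariantLift
          degree := fun n d p hp hd => h.equivariantLift_degree n d p hp (by simpa using hd) }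
      master := h.isMaurerCartan_equivariantLift
      restrict := hr
      restrict_eval := h.eval_eq_classicalAction hr }

end IsCyclicLInfinity

end Adjoint

/-! ## Positivity of the integral of densities -/

section DensityPositivity

variable (n : ℕ) {M : Type*} [TopologicalSpace M] [ChartedSpace (EuclideanSpace ℝ (Fin n)) M]
  [IsManifold (𝓡 n) ∞ M]

/-- Every tuple of tangent vectors is the image of a coordinate frame under an endomorphism. -/
lemma exists_endomorphism_coordinateFrame (c : M) {y : EuclideanSpace ℝ (Fin n)}
    (hy : y ∈ (chartAt (EuclideanSpace ℝ (Fin n)) c).target)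
    (v : Fin n → TangentSpace (𝓡 n) ((chartAt (EuclideanSpace ℝ (Fin n)) c).symm y)) :
    ∃ A : TangentSpace (𝓡 n) ((chartAt (EuclideanSpace ℝ (Fin n)) c).symm y) →ₗ[ℝ]
      TangentSpace (𝓡 n) ((chartAt (EuclideanSpace ℝ (Fin n)) c).symm y),
      ∀ i, A (mfderiv (𝓡 n) (𝓡 n) (chartAt (EuclideanSpace ℝ (Fin n)) c).symm y
        (EuclideanSpace.single i (1 : ℝ))) = v i := by
  have hinv : (mfderiv (𝓡 n) (𝓡 n) (chartAt (EuclideanSpace ℝ (Fin n)) c).symm y).IsInvertible := by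
    have := isInvertible_mfderivWithin_extChartAt_symm (I := 𝓡 n) (x := c) (y := y)
      (by simpa using hy)
    rw [ModelWithCorners.range_eq_univ, mfderivWithin_univ] at this
    exact this
  obtain ⟨L', hL⟩ := hinv
  let L : EuclideanSpace ℝ (Fin n) ≃L[ℝ]
    TangentSpace (𝓡 n) ((chartAt (EuclideanSpace ℝ (Fin n)) c).symm y) := L'
  refine ⟨((EuclideanSpace.basisFun (Fin n) ℝ).toBasis.constr ℝ v).comp
    L.symm.toLinearEquiv.toLinearMap, fun i => ?_⟩
  rw [← hL]
  have h1 := (EuclideanSpace.basisFun (Fin n) ℝ).toBasis.constr_basis ℝ v i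
  simp only [OrthonormalBasis.coe_toBasis, EuclideanSpace.basisFun_apply] at h1
  have h2 : L.symm (L (EuclideanSpace.single i (1 : ℝ))) = EuclideanSpace.single i (1 : ℝ) :=
    L.symm_apply_apply _
  exact (congrArg _ h2).trans h1

/-- The factor is an absolute determinant, so both the vanishing and the sign of a density can be
read off in one chart. -/
lemma density_apply_eq (μ : ∀ x : M, DensityAt n x) (c : M) {x : M}
    (hx : x ∈ (chartAt (EuclideanSpace ℝ (Fin n)) c).source)
    (v : Fin n → TangentSpace (𝓡 n) x) :
    ∃ r : ℝ, 0 ≤ r ∧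
      (μ x).1 v = r * densCoord n μ c (chartAt (EuclideanSpace ℝ (Fin n)) c x) := by
  obtain ⟨y, hy, rfl⟩ : ∃ y ∈ (chartAt (EuclideanSpace ℝ (Fin n)) c).target,
      (chartAt (EuclideanSpace ℝ (Fin n)) c).symm y = x :=
    ⟨_, (chartAt (EuclideanSpace ℝ (Fin n)) c).map_source hx,
      (chartAt (EuclideanSpace ℝ (Fin n)) c).left_inv hx⟩
  obtain ⟨A, hA⟩ := exists_endomorphism_coordinateFrame n c hy v
  refine ⟨|LinearMap.det A|, abs_nonneg _, ?_⟩
  rw [(chartAt (EuclideanSpace ℝ (Fin n)) c).right_inv hy, densCoord,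
    ← (μ ((chartAt (EuclideanSpace ℝ (Fin n)) c).symm y)).2 A]
  exact congrArg _ (funext fun i => (hA i).symm)

lemma densCoord_ne_zero {μ : ∀ x : M, DensityAt n x} {c x : M}
    (hx : x ∈ (chartAt (EuclideanSpace ℝ (Fin n)) c).source) (h : μ x ≠ 0) :
    densCoord n μ c (chartAt (EuclideanSpace ℝ (Fin n)) c x) ≠ 0 := by
  intro h0
  apply h
  refine Subtype.ext (funext fun v => ?_)
  obtain ⟨r, -, hr⟩ := density_apply_eq n μ c hx v
  rw [hr, h0, mul_zero]
  rfl

/-- A nonnegative density which does not vanish identically has a positive integral. -/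
lemma densInt_pos [T2Space M] [SigmaCompactSpace M] {μ : ∀ x : M, DensityAt n x}
    (hs : μ ∈ SmoothDensity n M) (hc : DensCompact n μ)
    (h0 : ∀ (x : M) (v : Fin n → TangentSpace (𝓡 n) x), 0 ≤ (μ x).1 v) {x : M} (hx : μ x ≠ 0) :
    0 < densInt n μ := by
  have hnn : ∀ (c : M) (y : EuclideanSpace ℝ (Fin n)), 0 ≤ chartPartition n M c
      ((chartAt (EuclideanSpace ℝ (Fin n)) c).symm y) * densCoord n μ c y := fun c y =>
    mul_nonneg ((chartPartition n M).nonneg _ _) (h0 _ _)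
  refine finsum_pos (fun c => integral_nonneg fun y => hnn c y) ?_ (densInt_finite n hc)
  -- In a chart whose weight is positive at x the integrand is nonzero on a nonempty open set, which
  -- has positive measure.
  obtain ⟨c, hcx⟩ := (chartPartition n M).exists_pos_of_mem (mem_univ x)
  have hxc : x ∈ (chartAt (EuclideanSpace ℝ (Fin n)) c).source :=
    chartPartition_subordinate n c (subset_tsupport _ hcx.ne')
  refine ⟨c, ?_⟩
  set e := chartAt (EuclideanSpace ℝ (Fin n)) c with he
  rw [setIntegral_pos_iff_support_of_nonneg_ae (Filter.Eventually.of_forall fun y => hnn c y)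
    (densInt_integrable n hs hc c)]
  have hcont : ContinuousOn (fun y => chartPartition n M c (e.symm y) * densCoord n μ c y)
      e.target :=
    (((chartPartition n M c).2.continuous).comp_continuousOn e.continuousOn_symm).mul
      (hs c).continuousOn
  have hopen := hcont.isOpen_inter_preimage e.open_target (isOpen_compl_singleton (x := (0 : ℝ)))
  rw [inter_comm]
  refine hopen.measure_pos volume ⟨e x, e.map_source hxc, ?_⟩
  simp only [mem_preimage, mem_compl_iff, mem_singleton_iff, e.left_inv hxc]
  exact mul_ne_zero hcx.ne' (densCoord_ne_zero n hxc hx)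

end DensityPositivity

/-! ## Sections with compact support -/

section Sections

variable {n : ℕ} {M : Type*} [TopologicalSpace M] [ChartedSpace (EuclideanSpace ℝ (Fin n)) M]
  [IsManifold (𝓡 n) ∞ M] [T2Space M]
  {F : Type*} [NormedAddCommGroup F] [NormedSpace ℝ F]
  {E : M → Type*} [TopologicalSpace (TotalSpace F E)] [∀ x, TopologicalSpace (E x)]
  [FiberBundle F E] [∀ x, AddCommGroup (E x)] [∀ x, Module ℝ (E x)] [VectorBundle ℝ F E]

lemma exists_cSec_eq [ContMDiffVectorBundle ∞ F E (𝓡 n)] {x : M} (e : E x) :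
    ∃ t : CSec n F E, t.1 x = e := by
  obtain ⟨s, hs, hse⟩ := FiberBundle.exists_contMDiffOn_extend (k := ∞) (𝓡 n) F e
  obtain ⟨f, -, hf⟩ := (SmoothBumpFunction.nhds_basis_tsupport (I := 𝓡 n) x).mem_iff.1
    (interior_mem_nhds.2 hs)
  refine ⟨⟨⟨(f : M → ℝ) • FiberBundle.extend F e,
    (f.contMDiff.contMDiffOn (s := interior s)).smul_section_of_tsupport isOpen_interior hf
      (hse.mono interior_subset)⟩, tsupport f, f.hasCompactSupport, fun y hy => ?_⟩, ?_⟩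
  · change f y • FiberBundle.extend F e y = 0
    rw [image_eq_zero_of_notMem_tsupport hy, zero_smul]
  · change f x • FiberBundle.extend F e x = e
    rw [f.eq_one, one_smul]
    simp

/-- The product of a bump function with a section. -/
noncomputable def bumpSection {c : M} (f : SmoothBumpFunction (𝓡 n) c) (t : Sec n F E) : CSec n F E :=
  ⟨⟨(f : M → ℝ) • (t : ∀ x, E x), f.contMDiff.smul_section t.contMDiff⟩, tsupport f,
    f.hasCompactSupport, fun y hy => by
      change f y • t y = 0
      rw [image_eq_zero_of_notMem_tsupport hy, zero_smul]⟩

lemma bumpSection_apply {c : M} (f : SmoothBumpFunction (𝓡 n) c) (t : Sec n F E) (x : M) :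
    (bumpSection f t).1 x = f x • t x := rfl

/-- The integral of a fibrewise nondegenerate pairing is nondegenerate. -/
lemma BundlePairing.int_nondegenerate [SigmaCompactSpace M] [ContMDiffVectorBundle ∞ F E (𝓡 n)]
    (P : BundlePairing n F E) (hP : ∀ (x : M) (a : E x), (∀ b, P.pair x a b = 0) → a = 0)
    (s : CSec n F E) (hs : ∀ t, P.int s t = 0) : s = 0 := by
  refine Subtype.ext (ContMDiffSection.ext fun x => hP x _ fun b => ?_)
  by_contra hb
  -- A bump function supported where the coordinate density stays positive would turn t into a
  -- section with positive pairing. A negative value at x is excluded by applying this to -t.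
  have key : ∀ t : CSec n F E, ¬ 0 < densCoord n (fun x => P.pair x (s.1 x) (t.1 x)) x
      (chartAt (EuclideanSpace ℝ (Fin n)) x x) := by
    intro t hpos
    set e := chartAt (EuclideanSpace ℝ (Fin n)) x with he
    set μ := fun x => P.pair x (s.1 x) (t.1 x) with hμ
    have hcont : ContinuousOn (fun x' => densCoord n μ x (e x')) e.source :=
      ((P.smooth s.1 t.1) x).continuousOn.comp e.continuousOn e.mapsTo
    have hx : x ∈ e.source := mem_chart_source _ x
    have hU : e.source ∩ {x' | 0 < densCoord n μ x (e x')} ∈ 𝓝 x :=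
      (hcont.isOpen_inter_preimage e.open_source isOpen_Ioi).mem_nhds ⟨hx, hpos⟩
    obtain ⟨f, -, hf⟩ := (SmoothBumpFunction.nhds_basis_tsupport (I := 𝓡 n) x).mem_iff.1 hU
    have hν : (fun x' => P.pair x' (s.1 x') ((bumpSection f t.1).1 x')) = fun x' => f x' • μ x' :=
      funext fun x' => by rw [bumpSection_apply, map_smul]
    have h1 := densInt_pos n (P.smooth s.1 (bumpSection f t.1).1)
      (P.compact s (bumpSection f t.1)) (fun x' v => ?_) (x := x) ?_
    · exact h1.ne' (hs (bumpSection f t.1))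
    · have h2 := congrFun hν x'
      rw [h2]
      change 0 ≤ f x' * (μ x').1 v
      by_cases hfx : f x' = 0
      · rw [hfx, zero_mul]
      · have hx' := hf (subset_tsupport _ hfx)
        obtain ⟨r, hr, hrv⟩ := density_apply_eq n μ x hx'.1 v
        rw [hrv]
        exact mul_nonneg f.nonneg (mul_nonneg hr (le_of_lt hx'.2))
    · have h2 := congrFun hν x
      rw [h2, f.eq_one, one_smul]
      intro h0
      refine hpos.ne' ?_
      unfold densCoord
      have h3 : ∀ x', x' = x → μ x' = 0 := by
        rintro _ rfl
        exact h0
      rw [h3 _ (e.left_inv hx)]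
      rfl
  obtain ⟨t, ht⟩ := exists_cSec_eq (n := n) (F := F) b
  have hne : densCoord n (fun x => P.pair x (s.1 x) (t.1 x)) x
      (chartAt (EuclideanSpace ℝ (Fin n)) x x) ≠ 0 :=
    densCoord_ne_zero n (mem_chart_source _ x) (by rwa [ht])
  rcases hne.lt_or_gt with h | h
  · refine key (-t) ?_
    have : (fun x => P.pair x (s.1 x) ((-t).1 x)) = -fun x => P.pair x (s.1 x) (t.1 x) :=
      funext fun x => by
        change P.pair x (s.1 x) (-(t.1 x)) = _
        rw [map_neg]
        rfl
    rw [this]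
    change 0 < -_
    exact neg_pos.2 h
  · exact key t h

end Sections

/-! ## The cyclic algebra of compactly supported sections -/

section Restriction

variable {V Z : Type*} [AddCommGroup V] [Module ℝ V] [AddCommGroup Z] [Module ℝ Z]

lemma restrictBr_coe (br : Brackets V) (U : Submodule ℝ V)
    (h : ∀ (k : ℕ) (v : Fin k → V), (∀ i, v i ∈ U) → br k v ∈ U) {k : ℕ} (v : Fin k → U) :
    (restrictBr br U h k v : V) = br k (fun i => (v i : V)) := rfl

lemma insertion_restrictBr_coe (br : Brackets V) (U : Submodule ℝ V)
    (h : ∀ (k : ℕ) (v : Fin k → V), (∀ i, v i ∈ U) → br k v ∈ U) {n : ℕ} (d : Fin n → ℤ)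
    (v : Fin n → U) :
    ((insertion (restrictBr br U h) (restrictBr br U h) d v : U) : V) =
      insertion br br d (fun i => (v i : V)) := by
  rw [insertion_eq, insertion_eq, ← U.subtype_apply, map_sum]
  refine Finset.sum_congr rfl fun S _ => ?_
  have hs : ∀ (ε : ℤˣ) (a : U), U.subtype (ε • a) = ε • U.subtype a := fun ε a => by
    rcases Int.units_eq_one_or ε with rfl | rfl <;> simp
  rw [hs]
  congr 1
  simp only [evalOn, U.subtype_apply, restrictBr_coe]
  congr 1
  funext i
  refine i.cases ?_ fun i => ?_ <;> simp [restrictBr_coe, Function.comp_def]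

/-- Naturality of the lift in its arguments; with naturality in its values, it relates lifts of
integrated functionals to lifts of their densities. -/
lemma equivariantLift_compLinearMap {U : Type*} [AddCommGroup U] [Module ℝ U] {k : ℕ}
    (f : MultilinearMap ℝ (fun _ : Fin k => V) Z) (φ : U →ₗ[ℝ] V) (p : Fin k → U × U) :
    equivariantLift (f.compLinearMap fun _ => φ) p =
      equivariantLift f (fun i => (φ (p i).1, φ (p i).2)) := by
  simp only [equivariantLift_apply, MultilinearMap.compLinearMap_apply, map_add]
  congr 1
  refine Finset.sum_congr rfl fun i _ => ?_
  congr 1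
  funext j
  by_cases hj : j = i
  · subst hj
    simp
  · simp [hj]

lemma equivariantLift_compMultilinearMap {Z' : Type*} [AddCommGroup Z'] [Module ℝ Z'] {k : ℕ}
    (f : MultilinearMap ℝ (fun _ : Fin k => V) Z) (φ : Z →ₗ[ℝ] Z') (p : Fin k → V × V) :
    equivariantLift (φ.compMultilinearMap f) p = φ (equivariantLift f p) := by
  simp only [equivariantLift_apply, LinearMap.compMultilinearMap_apply, map_sub, map_sum]

end Restriction

section Local

variable {n : ℕ} {M : Type*} [TopologicalSpace M] [ChartedSpace (EuclideanSpace ℝ (Fin n)) M]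
  {F : Type*} [NormedAddCommGroup F] [NormedSpace ℝ F]
  {E : M → Type*} [TopologicalSpace (TotalSpace F E)] [∀ x, TopologicalSpace (E x)]
  [FiberBundle F E] [∀ x, AddCommGroup (E x)] [∀ x, Module ℝ (E x)] [VectorBundle ℝ F E]

/-- The homogeneous components of a compactly supported section. -/
noncomputable def BundleGrading.component (G : BundleGrading n F E) (d : ℤ) (s : CSec n F E) : CSec n F E :=
  ⟨⟨fun x => G.proj d x (s.1 x), G.smooth d s.1⟩, by
    obtain ⟨K, hK, h0⟩ := s.2
    exact ⟨K, hK, fun x hx => by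
      change G.proj d x (s.1 x) = 0
      rw [h0 x hx, map_zero]⟩⟩

/-- Independence is inherited from all sections; the span is everything because the fibrewise
projections do not enlarge supports. -/
lemma BundleGrading.isInternal_grc (G : BundleGrading n F E) (h : DirectSum.IsInternal G.gr) :
    DirectSum.IsInternal G.grc := by
  rw [DirectSum.isInternal_submodule_iff_iSupIndep_and_iSup_eq_top] at *
  simp only [iSupIndep_iff_finsetSum_eq_zero_imp_eq_zero] at *
  refine ⟨fun s v hv h0 i hi => ?_, ?_⟩
  · refine Subtype.ext (h.1 s (fun i => (v i).1) (fun i hi => hv i hi) ?_ i hi)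
    rw [← AddSubmonoidClass.coe_finsetSum, h0]
    rfl
  · rw [eq_top_iff]
    intro s _
    have hs : s = ∑ d ∈ G.degrees, G.component d s := by
      refine Subtype.ext (ContMDiffSection.ext fun x => ?_)
      have : (∑ d ∈ G.degrees, G.component d s).1 x =
          ∑ d ∈ G.degrees, G.proj d x (s.1 x) := by
        let ev : CSec n F E →+ E x :=
          { toFun := fun s => s.1 x
            map_zero' := rfl
            map_add' := fun _ _ => rfl }
        exact map_sum ev _ _
      rw [this, G.sum_proj]
    rw [hs]
    refine Submodule.sum_mem _ fun d _ => Submodule.mem_iSup_of_mem d ?_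
    intro x
    change G.proj d x (G.proj d x (s.1 x)) = G.proj d x (s.1 x)
    rw [G.proj_proj, if_pos rfl]

section Pairing

variable [FiniteDimensional ℝ F] [IsManifold (𝓡 n) ∞ M] [T2Space M] [SigmaCompactSpace M]

lemma IsLocalLInfinity.isLInfinity_cBr {G : BundleGrading n F E} {br : Brackets (Sec n F E)}
    (h : IsLocalLInfinity G br) : IsLInfinity G.grc h.cBr where
  graded := G.isInternal_grc h.isLInfinity.graded
  uncurved := by
    refine MultilinearMap.ext fun v => Subtype.ext ?_
    change br 0 _ = 0
    rw [h.isLInfinity.uncurved]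
    rfl
  degree := fun k d v hv => h.isLInfinity.degree k d (fun i => (v i).1) hv
  antisymm := fun k d v hv σ => by
    refine Subtype.ext ((h.isLInfinity.antisymm k d (fun i => (v i).1) hv σ).trans ?_)
    rcases Int.units_eq_one_or (chiSign d σ) with hσ | hσ <;> rw [hσ]
    · simp only [one_smul]
      rfl
    · simp only [Units.neg_smul, one_smul]
      rfl
  jacobi := fun m d v hv => Subtype.ext <|
    (insertion_restrictBr_coe br (CSec n F E) h.cSec d v).trans
      (h.isLInfinity.jacobi m d (fun i => (v i).1) hv)

lemma densInt_zero : densInt n (0 : ∀ x : M, DensityAt n x) = 0 := by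
  simpa using densInt_smul n (0 : ℝ) (0 : ∀ x : M, DensityAt n x)

theorem IsLocalCyclicLInfinity.isCyclicLInfinity_cBr [ContMDiffVectorBundle ∞ F E (𝓡 n)]
    {G : BundleGrading n F E} {br : Brackets (Sec n F E)} {P : BundlePairing n F E}
    (h : IsLocalCyclicLInfinity G br P) : IsCyclicLInfinity G.grc h.isLocal.cBr P.int where
  isLInfinity := h.isLocal.isLInfinity_cBr
  symm := fun d e a b ha hb => by
    change densInt n _ = (d * e).negOnePow • densInt n _
    have h1 : (fun x => P.pair x (a.1 x) (b.1 x)) =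
        fun x => (d * e).negOnePow • P.pair x (b.1 x) (a.1 x) :=
      funext fun x => h.symm d e x _ _ (ha x) (hb x)
    rw [h1]
    rcases Int.units_eq_one_or (d * e).negOnePow with hd | hd <;> rw [hd]
    · simp only [one_smul]
    · simp only [Units.neg_smul, one_smul]
      rw [← neg_one_mul, ← densInt_smul]
      congr 1
      funext x
      exact (neg_one_smul ℝ _).symm
  degree := fun d e a b ha hb hde => by
    change densInt n _ = 0
    have h1 : (fun x => P.pair x (a.1 x) (b.1 x)) = 0 :=
      funext fun x => h.degree d e x _ _ (ha x) (hb x) hde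
    rw [h1, densInt_zero]
  nondegenerate := P.int_nondegenerate h.nondegenerate
  invariant := h.invariant

end Pairing

/-! ## Locality -/

section PolyDiff

variable {Z : Type*} [AddCommGroup Z] [Module ℝ Z] {k r : ℕ} {x : M} {N : Submodule ℝ Z}
  {f : MultilinearMap ℝ (fun _ : Fin k => Sec n F E) Z} {p : Fin k → Sec n F E × Sec n F E}
  {i : Fin k}

/-- `VanishesToOrder` asks for a single product, a form that a sum of two such sections need not
visibly have; multilinearity splits the slot instead. -/
lemma map_add_mem_of_vanishesToOrder
    (hf : ∀ (v : Fin k → Sec n F E) (i : Fin k), VanishesToOrder r x (v i) → f v ∈ N)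
    (hp : VanishesToOrderSum r x (p i)) : f (fun j => (p j).1 + (p j).2) ∈ N := by
  have h1 := f.map_update_add (fun j => (p j).1 + (p j).2) i (p i).1 (p i).2
  rw [show Function.update (fun j => (p j).1 + (p j).2) i ((p i).1 + (p i).2) =
    fun j => (p j).1 + (p j).2 from Function.update_eq_self i _] at h1
  rw [h1]
  exact N.add_mem (hf _ i (by simpa using hp.1)) (hf _ i (by simpa using hp.2))

/-- Every summand of the lift carries X + u, X or u in slot i. -/
lemma equivariantLift_mem_of_vanishesToOrder
    (hf : ∀ (v : Fin k → Sec n F E) (i : Fin k), VanishesToOrder r x (v i) → f v ∈ N)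
    (hp : VanishesToOrderSum r x (p i)) : equivariantLift f p ∈ N := by
  rw [equivariantLift_apply]
  refine N.sub_mem (N.sub_mem (map_add_mem_of_vanishesToOrder hf hp) (hf _ i hp.1))
    (N.sum_mem fun j _ => hf _ i ?_)
  by_cases hj : i = j
  · subst hj
    simpa using hp.2
  · simpa [hj] using hp.1

lemma actionLift_mem_of_vanishesToOrder
    (hf : ∀ (v : Fin k → Sec n F E) (i : Fin k), VanishesToOrder r x (v i) → f v ∈ N)
    (hp : VanishesToOrderSum r x (p i)) : actionLift f p ∈ N := by
  rw [actionLift_apply]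
  exact N.sub_mem (equivariantLift_mem_of_vanishesToOrder hf hp) (hf _ i hp.2)

end PolyDiff

/-- Sections which vanish at a point. -/
def vanishingAt (n : ℕ) (F : Type*) [NormedAddCommGroup F] [NormedSpace ℝ F] {M : Type*}
    [TopologicalSpace M] [ChartedSpace (EuclideanSpace ℝ (Fin n)) M] (E : M → Type*)
    [TopologicalSpace (TotalSpace F E)] [∀ x, TopologicalSpace (E x)] [FiberBundle F E]
    [∀ x, AddCommGroup (E x)] [∀ x, Module ℝ (E x)] [VectorBundle ℝ F E] (x : M) :
    Submodule ℝ (Sec n F E) where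
  carrier := {s | s x = 0}
  add_mem' := fun {s t} hs ht => by
    change s x + t x = 0
    rw [show s x = 0 from hs, show t x = 0 from ht, add_zero]
  zero_mem' := rfl
  smul_mem' := fun c s hs => by
    change c • s x = 0
    rw [show s x = 0 from hs, smul_zero]

/-- Smooth densities which vanish at a point. -/
def densityVanishingAt (n : ℕ) {M : Type*} [TopologicalSpace M]
    [ChartedSpace (EuclideanSpace ℝ (Fin n)) M] (x : M) : Submodule ℝ (SmoothDensity n M) where
  carrier := {μ | μ.1 x = 0}
  add_mem' := fun {s t} hs ht => by
    change s.1 x + t.1 x = 0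
    rw [show s.1 x = 0 from hs, show t.1 x = 0 from ht, add_zero]
  zero_mem' := rfl
  smul_mem' := fun c s hs => by
    change c • s.1 x = 0
    rw [show s.1 x = 0 from hs, smul_zero]

lemma IsLocalLInfinity.isPolyDiff_infAdjoint {G : BundleGrading n F E}
    {br : Brackets (Sec n F E)} (h : IsLocalLInfinity G br) (k : ℕ) :
    IsPolyDiff VanishesToOrderSum
      (fun x (p : Sec n F E × Sec n F E) => p.1 x = 0 ∧ p.2 x = 0) (infAdjoint br k) := by
  obtain ⟨r, hr⟩ := h.isPolyDiff k
  refine ⟨r, fun p i x hp => ⟨hr _ i x hp.1, ?_⟩⟩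
  rw [infAdjoint_snd]
  exact (vanishingAt n F E x).sub_mem
    (map_add_mem_of_vanishesToOrder (fun v i hv => hr v i x hv) hp) (hr _ i x hp.1)

/-! ### Densities of the lifted functionals. -/

section Functionals

variable (P : BundlePairing n F E) (br : Brackets (Sec n F E))

/-- The density-valued pairing of sections. -/
noncomputable def BundlePairing.density : Sec n F E →ₗ[ℝ] Sec n F E →ₗ[ℝ] SmoothDensity n M :=
  LinearMap.mk₂ ℝ (fun s t => ⟨fun x => P.pair x (s x) (t x), P.smooth s t⟩)
    (fun s s' t => Subtype.ext (funext fun x => by simp))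
    (fun c s t => Subtype.ext (funext fun x => by simp))
    (fun s t t' => Subtype.ext (funext fun x => by simp))
    (fun c s t => Subtype.ext (funext fun x => by simp))

/-- The density of the classical action functional. -/
noncomputable def classicalDensity : MultiFamily (Sec n F E) (SmoothDensity n M)
  | 0 => 0
  | k + 1 => MultilinearMap.uncurryRight (M := fun _ : Fin (k + 1) => Sec n F E)
      (P.density.compMultilinearMap (br k))

lemma classicalDensity_succ_apply {k : ℕ} (v : Fin (k + 1) → Sec n F E) (x : M) :
    (classicalDensity P br (k + 1) v).1 x =
      P.pair x (br k (fun i => v i.castSucc) x) (v (Fin.last k) x) := rfl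

omit [VectorBundle ℝ F E] in
lemma VanishesToOrder.apply_eq_zero {r : ℕ} {x : M} {s : Sec n F E} (h : VanishesToOrder r x s) :
    s x = 0 := by
  obtain ⟨f, t, hf, hs⟩ := h
  -- The product has r + 1 factors, so at least one even when r = 0.
  rw [hs, Fin.prod_univ_succ, hf 0, zero_mul, zero_smul]

/-- The slots of the bracket inherit its order, and the last argument enters through the fibrewise
pairing, without derivatives. -/
lemma exists_classicalDensity_mem {br : Brackets (Sec n F E)}
    (h : ∀ k, IsPolyDiff VanishesToOrder (fun x (s : Sec n F E) => s x = 0) (br k)) (k : ℕ) :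
    ∃ r, ∀ (x : M) (v : Fin k → Sec n F E) (i : Fin k), VanishesToOrder r x (v i) →
      classicalDensity P br k v ∈ densityVanishingAt n x := by
  rcases k with _ | k
  · exact ⟨0, fun x v i => i.elim0⟩
  obtain ⟨r, hr⟩ := h k
  refine ⟨r, fun x v i hv => ?_⟩
  change (classicalDensity P br (k + 1) v).1 x = 0
  rw [classicalDensity_succ_apply]
  revert hv
  refine i.lastCases (fun hv => ?_) fun i hv => ?_
  · rw [hv.apply_eq_zero, map_zero]
  · rw [hr (fun i => v i.castSucc) i x hv, map_zero, LinearMap.zero_apply]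

variable (n M) in
/-- Smooth densities with compact support. -/
def compactDensity : Submodule ℝ (∀ x : M, DensityAt n x) where
  carrier := {μ | μ ∈ SmoothDensity n M ∧ DensCompact n μ}
  add_mem' := by
    rintro μ ν ⟨hμs, K, hK, hμ⟩ ⟨hνs, K', hK', hν⟩
    refine ⟨Submodule.add_mem _ hμs hνs, K ∪ K', hK.union hK', fun x hx => ?_⟩
    rw [mem_union, not_or] at hx
    rw [Pi.add_apply, hμ x hx.1, hν x hx.2, add_zero]
  zero_mem' := ⟨Submodule.zero_mem _, ∅, isCompact_empty, fun _ _ => rfl⟩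
  smul_mem' := by
    rintro c μ ⟨hμs, K, hK, hμ⟩
    refine ⟨Submodule.smul_mem _ c hμs, K, hK, fun x hx => ?_⟩
    rw [Pi.smul_apply, hμ x hx, smul_zero]

/-- The density of the classical action functional, on compactly supported sections. -/
noncomputable def classicalCompactDensity (k : ℕ) :
    MultilinearMap ℝ (fun _ : Fin k => CSec n F E) (compactDensity n M) :=
  ((SmoothDensity n M).subtype.compMultilinearMap
    ((classicalDensity P br k).compLinearMap fun _ => (CSec n F E).subtype)).codRestrict _
    fun v => by
      refine ⟨Subtype.property _, ?_⟩
      rcases k with _ | k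
      · exact ⟨∅, isCompact_empty, fun _ _ => rfl⟩
      · obtain ⟨K, hK, h0⟩ := (v (Fin.last k)).2
        refine ⟨K, hK, fun x hx => ?_⟩
        refine (classicalDensity_succ_apply P br _ x).trans ?_
        rw [Submodule.subtype_apply, h0 x hx, map_zero]

lemma coe_equivariantLift_classicalCompactDensity {k : ℕ}
    (p : Fin k → CSec n F E × CSec n F E) :
    (equivariantLift (Z := compactDensity n M) (classicalCompactDensity P br k) p).1 =
      (equivariantLift (Z := SmoothDensity n M) (classicalDensity P br k)
        (fun i => ((p i).1.1, (p i).2.1))).1 := by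
  have h1 := equivariantLift_compMultilinearMap (Z := compactDensity n M)
    (classicalCompactDensity P br k) (compactDensity n M).subtype p
  have h2 := equivariantLift_compMultilinearMap (Z := SmoothDensity n M)
    ((classicalDensity P br k).compLinearMap fun _ => (CSec n F E).subtype)
    (SmoothDensity n M).subtype p
  have h3 := equivariantLift_compLinearMap (Z := SmoothDensity n M) (classicalDensity P br k)
    (CSec n F E).subtype p
  exact h1.symm.trans (h2.trans (congrArg (SmoothDensity n M).subtype h3))

variable [IsManifold (𝓡 n) ∞ M] [T2Space M] [SigmaCompactSpace M]

variable (n M) in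
/-- The integral as a linear functional on compactly supported densities. -/
noncomputable def compactDensityInt : compactDensity n M →ₗ[ℝ] ℝ where
  toFun μ := densInt n μ.1
  map_add' μ ν := densInt_add n μ.2.1 ν.2.1 μ.2.2 ν.2.2
  map_smul' c μ := densInt_smul n c μ.1

variable {br P} [FiniteDimensional ℝ F] {G : BundleGrading n F E}

lemma compactDensityInt_comp_classicalCompactDensity (h : IsLocalLInfinity G br) (k : ℕ) :
    (compactDensityInt n M).compMultilinearMap (classicalCompactDensity P br k) =
      classicalCochain h.cBr P.int k := by
  rcases k with _ | k
  · refine MultilinearMap.ext fun v => ?_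
    exact densInt_zero
  · rfl

/-- `compactDensityInt` makes integration a linear map on compactly supported densities, so the lift
passes through the integral there and is then compared with the lift of the density on all sections.
-/
lemma equivariantLift_classicalCochain_eq_densInt (h : IsLocalLInfinity G br) (k : ℕ)
    (p : Fin k → CSec n F E × CSec n F E) :
    equivariantLift (classicalCochain h.cBr P.int k) p =
      densInt n (equivariantLift (Z := SmoothDensity n M) (classicalDensity P br k)
        (fun i => ((p i).1.1, (p i).2.1))).1 := by
  have h1 := equivariantLift_compMultilinearMap (Z := compactDensity n M)
    (classicalCompactDensity P br k) (compactDensityInt n M) p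
  rw [← coe_equivariantLift_classicalCompactDensity,
    ← compactDensityInt_comp_classicalCompactDensity]
  exact h1

lemma actionLift_classicalCochain_eq_densInt (h : IsLocalLInfinity G br) (k : ℕ)
    (p : Fin k → CSec n F E × CSec n F E) :
    actionLift (classicalCochain h.cBr P.int k) p =
      densInt n (actionLift (Z := SmoothDensity n M) (classicalDensity P br k)
        (fun i => ((p i).1.1, (p i).2.1))).1 := by
  have h1 := equivariantLift_compMultilinearMap (Z := compactDensity n M)
    (classicalCompactDensity P br k) (compactDensityInt n M) p
  have h2 := map_sub (compactDensityInt n M)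
    (equivariantLift (Z := compactDensity n M) (classicalCompactDensity P br k) p)
    (classicalCompactDensity P br k (fun i => (p i).2))
  have h3 : (actionLift (Z := SmoothDensity n M) (classicalDensity P br k)
      (fun i => ((p i).1.1, (p i).2.1))).1 =
      (equivariantLift (Z := compactDensity n M) (classicalCompactDensity P br k) p).1 -
        (classicalCompactDensity P br k (fun i => (p i).2)).1 := by
    rw [coe_equivariantLift_classicalCompactDensity]
    rfl
  rw [h3, ← compactDensityInt_comp_classicalCompactDensity, actionLift_apply]
  exact (congrArg (fun t => t - compactDensityInt n M
    (classicalCompactDensity P br k (fun i => (p i).2))) h1).trans h2.symm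

lemma isLocalFunctional_equivariantLift (h : IsLocalLInfinity G br) (k : ℕ) :
    IsLocalFunctional (equivariantLift (classicalCochain h.cBr P.int k)) := by
  obtain ⟨r, hr⟩ := exists_classicalDensity_mem P h.isPolyDiff k
  have hmem : ∀ (p : Fin k → Sec n F E × Sec n F E) (i : Fin k) (x : M),
      VanishesToOrderSum r x (p i) → equivariantLift (Z := SmoothDensity n M)
        (classicalDensity P br k) p ∈ densityVanishingAt n x :=
    fun p i x hp => equivariantLift_mem_of_vanishesToOrder (Z := SmoothDensity n M) (hr x) hp
  exact ⟨equivariantLift (Z := SmoothDensity n M) (classicalDensity P br k), ⟨r, hmem⟩,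
    equivariantLift_classicalCochain_eq_densInt h k⟩

lemma isLocalFunctional_actionLift (h : IsLocalLInfinity G br) (k : ℕ) :
    IsLocalFunctional (actionLift (classicalCochain h.cBr P.int k)) := by
  obtain ⟨r, hr⟩ := exists_classicalDensity_mem P h.isPolyDiff k
  have hmem : ∀ (p : Fin k → Sec n F E × Sec n F E) (i : Fin k) (x : M),
      VanishesToOrderSum r x (p i) → actionLift (Z := SmoothDensity n M)
        (classicalDensity P br k) p ∈ densityVanishingAt n x :=
    fun p i x hp => actionLift_mem_of_vanishesToOrder (Z := SmoothDensity n M) (hr x) hp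
  exact ⟨actionLift (Z := SmoothDensity n M) (classicalDensity P br k), ⟨r, hmem⟩,
    actionLift_classicalCochain_eq_densInt h k⟩

end Functionals

end Local

theorem theorem4p1 :
    -- cyclic algebras without locality
    (∀ (V : Type*) [AddCommGroup V] [Module ℝ V] (gr : ℤ → Submodule ℝ V) (br : Brackets V)
      (B : V →ₗ[ℝ] V →ₗ[ℝ] ℝ), IsCyclicLInfinity gr br B →
      IsAction gr br gr br (infAdjoint br) ∧
      IsCompatible gr gr (infAdjoint br) B ∧
      ∃ SL : Cochain (V × V),
        IsHamiltonianBy gr br gr br B (infAdjoint br) SL ∧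
        IsEquivariantAction gr br gr br B (totalCochain br B SL)) ∧
    -- cyclic local algebras on a manifold
    (∀ (n : ℕ) (M : Type*) [TopologicalSpace M] [ChartedSpace (EuclideanSpace ℝ (Fin n)) M]
      [IsManifold (𝓡 n) ∞ M] [T2Space M] [SigmaCompactSpace M]
      (F : Type*) [NormedAddCommGroup F] [NormedSpace ℝ F] [FiniteDimensional ℝ F]
      (E : M → Type*) [TopologicalSpace (TotalSpace F E)] [∀ x, TopologicalSpace (E x)]
      [FiberBundle F E] [∀ x, AddCommGroup (E x)] [∀ x, Module ℝ (E x)] [VectorBundle ℝ F E]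
      [ContMDiffVectorBundle ∞ F E (𝓡 n)]
      (G : BundleGrading n F E) (br : Brackets (Sec n F E)) (P : BundlePairing n F E)
      (h : IsLocalCyclicLInfinity G br P),
      IsAction G.gr br G.gr br (infAdjoint br) ∧
      (∀ k, IsPolyDiff VanishesToOrderSum
        (fun x (p : Sec n F E × Sec n F E) => p.1 x = 0 ∧ p.2 x = 0) (infAdjoint br k)) ∧
      (∀ (k : ℕ) (p : Fin k → CSec n F E × CSec n F E),
        infAdjoint br k (fun i => ((p i).1.1, (p i).2.1)) =
          ((infAdjoint h.isLocal.cBr k p).1.1, (infAdjoint h.isLocal.cBr k p).2.1)) ∧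
      IsCompatible G.grc G.grc (infAdjoint h.isLocal.cBr) P.int ∧
      ∃ SL : Cochain (CSec n F E × CSec n F E),
        IsHamiltonianBy G.grc h.isLocal.cBr G.grc h.isLocal.cBr P.int
          (infAdjoint h.isLocal.cBr) SL ∧
        IsEquivariantAction G.grc h.isLocal.cBr G.grc h.isLocal.cBr P.int
          (totalCochain h.isLocal.cBr P.int SL) ∧
        (∀ k, IsLocalFunctional (SL k)) ∧
        (∀ k, IsLocalFunctional (totalCochain h.isLocal.cBr P.int SL k))) := by
  refine ⟨fun V _ _ gr br B h => ⟨h.isLInfinity.infAdjoint_isAction, h.infAdjoint_isCompatible,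
    _, h.isHamiltonianBy_actionLift, h.isEquivariantAction⟩, ?_⟩
  intro n M _ _ _ _ _ F _ _ _ E _ _ _ _ _ _ _ G br P h
  -- The algebraic statements now apply to compactly supported sections; only the action on all
  -- sections and locality remain separate.
  have hc := h.isCyclicLInfinity_cBr
  refine ⟨h.isLocal.isLInfinity.infAdjoint_isAction, h.isLocal.isPolyDiff_infAdjoint,
    fun k p => Prod.ext rfl ?_, hc.infAdjoint_isCompatible, _, hc.isHamiltonianBy_actionLift,
    hc.isEquivariantAction, isLocalFunctional_actionLift h.isLocal, ?_⟩
  · rw [infAdjoint_snd, infAdjoint_snd]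
    rfl
  · rw [IsCyclicLInfinity.totalCochain_actionLift]
    exact isLocalFunctional_equivariantLift h.isLocal
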